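/- For $n\ge 1$ let $\mathcal M_n([0,\infty))\subset\mathbb R^n$ be the set of all vectors $(m_1(\mu),\dots,m_n(\mu))$ of the first $n$ moments $m_i(\mu)=\int x^i\,d\mu(x)$ of probability measures $\mu$ on $[0,\infty)$ with finite moments up to order $n$. For $\vec m_n=(m_1,\dots,m_n)\in\mathcal M_n([0,\infty))$ and $1\le k\le n$ let $$m_k^-=\min\Big\{m_k(\mu)\ :\ \mu \text{ a probability measure on } [0,\infty),\ \int x^i\,d\mu(x)=m_i \text{ for } 1\le i\le k-1\Big\},$$ put $m_0=1$, $m_0^-=0$, and, if $m_i>m_i^-$ for $1\le i\le n$, let $z_k(\vec m_n)=\frac{m_k-m_k^-}{m_{k-1}-m_{k-1}^-}$. For real $\gamma_k>-1$ and $\delta_k>0$ let $$g_n^{(\gamma,\delta)}(\vec m_n)=\prod_{k=1}^n\frac{\delta_k^{\gamma_k+n-k+1}}{\Gamma(\gamma_k+n-k+1)}\;\prod_{k=1}^n z_k(\vec m_n)^{\gamma_k}e^{-\delta_k z_k(\vec m_n)}$$ if $\vec m_n\in\mathcal M_n([0,\infty))$ and $m_k>m_k^-$ for all $1\le k\le n$,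 and $g_n^{(\gamma,\delta)}=0$ elsewhere; this is a probability density with respect to Lebesgue measure on $\mathbb R^n$. **Theorem.** Let $(\gamma_k)_{k\ge1}$ be a fixed sequence of real numbers with $\gamma_k>-1$. For each $n$ let $\vec m_n$ be a random vector whose law has density $g_n^{(\gamma,\delta)}$ with $\delta_1=\dots=\delta_n=n$. Fix $k$, and for $n\ge k$ let $\vec m_k^{(n)}$ be the vector of the first $k$ coordinates of $\vec m_n$. Then $$\sqrt n\,C^{-1}\big(\vec m_k^{(n)}-\vec m_k(\eta)\big)\longrightarrow \mathcal N_k(0,I_k)\quad\text{in distribution as } n\to\infty.$$ Here $\vec m_k(\eta)$ is the vector of the first $k$ moments of the Marchenko–Pastur distribution $d\eta(x)=\frac{\sqrt{x(4-x)}}{2\pi x}\mathbf 1_{\{0<x<4\}}\,dx$; these moments are finite and equal to the Catalan numbers, $\vec m_k(\eta)=(c_1,\dots,c_k)$ with $c_i=\frac1{i+1}\binom{2i}{i}$. The matrix $C=(c_{i,j})_{1\le i,j\le k}$ is lower triangular with $c_{i,i}=1$ and $c_{i,j}=\binom{2i}{i-j}-\binom{2i}{i-j-1}$ for $j<i$.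 -/

import Mathlib

open MeasureTheory ProbabilityTheory

noncomputable section

/-- `μ` is a probability measure on `[0, ∞)` with finite moments up to order `k`, and for
`1 ≤ i ≤ k` its `i`-th moment is `c i`. (The value `c 0` plays no role.) -/
def HasMoments (μ : Measure ℝ) (k : ℕ) (c : ℕ → ℝ) : Prop :=
  IsProbabilityMeasure μ ∧ μ (Set.Iio 0) = 0 ∧
    ∀ i ∈ Finset.Icc 1 k, Integrable (fun x : ℝ => x ^ i) μ ∧ ∫ x, x ^ i ∂μ = c i

/-- The vector `(m₁, …, mₙ)`, stored with indices `0, …, n - 1`, read as the sequence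
`m₀ = 1, m₁, …, mₙ` (and `0` beyond `n`). -/
def momentSeq {n : ℕ} (m : Fin n → ℝ) : ℕ → ℝ
  | 0 => 1
  | k + 1 => if h : k < n then m ⟨k, h⟩ else 0

/-- The moment space `𝓜ₙ([0, ∞))`. -/
def momentSpace (n : ℕ) : Set (Fin n → ℝ) :=
  {m | ∃ μ : Measure ℝ, HasMoments μ n (momentSeq m)}

/-- The lower bound `mₖ⁻` : the least `k`-th moment of a probability measure on `[0, ∞)` whose
moments of orders `1, …, k - 1` are `c 1, …, c (k - 1)`; by convention `m₀⁻ = 0`. -/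
def lowerMoment (c : ℕ → ℝ) : ℕ → ℝ
  | 0 => 0
  | k + 1 => sInf {y | ∃ μ : Measure ℝ, HasMoments μ k c ∧
      Integrable (fun x : ℝ => x ^ (k + 1)) μ ∧ ∫ x, x ^ (k + 1) ∂μ = y}

/-- `zₖ = (mₖ - mₖ⁻) / (mₖ₋₁ - mₖ₋₁⁻)` for `k ≥ 1`. -/
def recursionVar (c : ℕ → ℝ) (k : ℕ) : ℝ :=
  (c k - lowerMoment c k) / (c (k - 1) - lowerMoment c (k - 1))

open Classical in
/-- The function `gₙ^(γ,δ)` on the moment space `𝓜ₙ([0, ∞))`, extended by `0` to `ℝⁿ`. The parameters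
are the values `γ k`, `δ k` for `1 ≤ k ≤ n`. -/
def momentDensity (n : ℕ) (γ δ : ℕ → ℝ) (m : Fin n → ℝ) : ℝ :=
  if m ∈ momentSpace n ∧
      ∀ k ∈ Finset.Icc 1 n, lowerMoment (momentSeq m) k < momentSeq m k then
    (∏ k ∈ Finset.Icc 1 n,
        δ k ^ (γ k + (n : ℝ) - (k : ℝ) + 1) / Real.Gamma (γ k + (n : ℝ) - (k : ℝ) + 1)) *
      ∏ k ∈ Finset.Icc 1 n, recursionVar (momentSeq m) k ^ γ k *
        Real.exp (-δ k * recursionVar (momentSeq m) k)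
  else 0

/-- The law on `ℝⁿ` with Lebesgue density `gₙ^(γ,δ)`. -/
def momentLaw (n : ℕ) (γ δ : ℕ → ℝ) : Measure (Fin n → ℝ) :=
  volume.withDensity fun m => ENNReal.ofReal (momentDensity n γ δ m)

/-- The Marchenko–Pastur distribution, with density `√(x (4 - x)) / (2 π x)` on `(0, 4)`. -/
def marchenkoPastur : Measure ℝ :=
  volume.withDensity fun x => ENNReal.ofReal
    ((Set.Ioo (0 : ℝ) 4).indicator (fun x => √(x * (4 - x)) / (2 * Real.pi * x)) x)

/-- The vector of the first `k` moments of the Marchenko–Pastur distribution. -/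
def marchenkoPasturMoments (k : ℕ) : Fin k → ℝ :=
  fun i => ∫ x, x ^ ((i : ℕ) + 1) ∂marchenkoPastur

/-- The projection of a vector of length `n` to its first `k` coordinates. It is used for `k ≤ n`;
for `k > n` the vector is padded with zeros. -/
def firstCoords (k : ℕ) {n : ℕ} (m : Fin n → ℝ) : Fin k → ℝ :=
  fun i => if h : (i : ℕ) < n then m ⟨i, h⟩ else 0

/-- The lower triangular matrix `C` with unit diagonal and, in indices starting at `1`, entries
`binom(2i, i - j) - binom(2i, i - j - 1)` for `j < i`. -/
def matrixC (k : ℕ) : Matrix (Fin k) (Fin k) ℝ :=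
  fun i j =>
    if j = i then 1
    else if j < i then
      (Nat.choose (2 * ((i : ℕ) + 1)) ((i : ℕ) - j) : ℝ)
        - (Nat.choose (2 * ((i : ℕ) + 1)) ((i : ℕ) - j - 1) : ℝ)
    else 0

end

open Filter
open scoped Topology

/-!
Let `Jₙ` be the symmetric tridiagonal matrix with zero diagonal and squared off-diagonal entries
`z₁, …, zₙ`. By Flajolet's path expansion the even moments of its spectral measure at the first
basis vector are sums over Dyck paths weighted by the `zₖ`, hence polynomials in `z`: the `k`-th one
is `z₁ ⋯ zₖ` plus a polynomial in `z₁, …, zₖ₋₁`. That last polynomial is the lower bound `mₖ⁻`,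
because the characteristic polynomial of the squared Jacobi matrix supplies, through
Cayley–Hamilton, a monic polynomial nonnegative on `[0, ∞)` whose expectation is `mₖ - mₖ⁻`. So `z`
consists of the canonical coordinates of the moment vector. The change of variables is triangular,
with Jacobian determinant `∏ zₖ ^ (n - k)`, and turns the density into that of independent
`Gamma(γₖ + n - k + 1, n)` variables. These fluctuate around `1` at scale `1 / √n` with standard
Gaussian limits, and the delta method transfers this to the moments. At `z = 1` the path sums are
the Catalan numbers, the Marchenko–Pastur moments, and the derivative there counts Dyck paths with a
marked step, which by the reflection principle gives the ballot numbers in `C`.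
-/

section ConvergenceInDistribution

lemma map_prodMk_const {Ω E F : Type*} [MeasurableSpace Ω] [MeasurableSpace E] [MeasurableSpace F]
    {μ : Measure Ω} [SFinite μ] {X : Ω → E} (hX : AEMeasurable X μ) (c : F) :
    μ.map (fun ω => (X ω, c)) = (μ.map X).prod (Measure.dirac c) := by
  rw [Measure.prod_dirac, AEMeasurable.map_map_of_aemeasurable (by fun_prop) hX]
  rfl

variable {ι Ω' Ω'' : Type*} {Ω₁ Ω₂ : ι → Type*}
  [∀ i, MeasurableSpace (Ω₁ i)] [∀ i, MeasurableSpace (Ω₂ i)]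
  {μ : ∀ i, Measure (Ω₁ i)} [∀ i, IsProbabilityMeasure (μ i)]
  {ν : ∀ i, Measure (Ω₂ i)} [∀ i, IsProbabilityMeasure (ν i)]
  [MeasurableSpace Ω'] {μ' : Measure Ω'} [IsProbabilityMeasure μ']
  [MeasurableSpace Ω''] {ν' : Measure Ω''} [IsProbabilityMeasure ν'] {l : Filter ι}

lemma tendstoInDistribution_of_eventually_map_eq {E : Type*} [TopologicalSpace E]
    [MeasurableSpace E] [OpensMeasurableSpace E] {X : ∀ i, Ω₁ i → E} {Y : ∀ i, Ω₂ i → E}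
    {Z : Ω' → E} {W : Ω'' → E} (hX : TendstoInDistribution X l Z μ μ')
    (hY : ∀ i, AEMeasurable (Y i) (ν i)) (hW : AEMeasurable W ν')
    (hXY : ∀ᶠ i in l, (ν i).map (Y i) = (μ i).map (X i)) (hZW : ν'.map W = μ'.map Z) :
    TendstoInDistribution Y l W ν ν' := by
  refine ⟨hY, hW, ?_⟩
  simp only [hZW]
  exact hX.tendsto.congr' (hXY.mono fun i hi => Subtype.ext hi.symm)

lemma tendstoInDistribution_prodMk_const {E F : Type*} [TopologicalSpace E]
    [SecondCountableTopology E] [TopologicalSpace.PseudoMetrizableSpace E] [MeasurableSpace E]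
    [BorelSpace E] [TopologicalSpace F] [SecondCountableTopology F]
    [TopologicalSpace.PseudoMetrizableSpace F] [MeasurableSpace F] [BorelSpace F]
    {X : ∀ i, Ω₁ i → E} {Z : Ω' → E} (hX : TendstoInDistribution X l Z μ μ') {s : ι → F} {s₀ : F}
    (hs : Tendsto s l (𝓝 s₀)) :
    TendstoInDistribution (fun i ω => (X i ω, s i)) l (fun ω => (Z ω, s₀)) μ μ' := by
  refine ⟨fun i => (hX.forall_aemeasurable i).prodMk aemeasurable_const,
    hX.aemeasurable_limit.prodMk aemeasurable_const, ?_⟩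
  have hprod := (ProbabilityMeasure.continuous_prod.tendsto _).comp
    (hX.tendsto.prodMk_nhds ((continuous_diracProba.tendsto s₀).comp hs))
  simp only [map_prodMk_const hX.aemeasurable_limit]
  exact hprod.congr fun i => Subtype.ext
    (map_prodMk_const (hX.forall_aemeasurable i) (s i)).symm

lemma tendstoInDistribution_pi_of_iIndepFun {κ : Type*} [Finite κ] {E : κ → Type*}
    [∀ j, TopologicalSpace (E j)] [∀ j, SecondCountableTopology (E j)]
    [∀ j, TopologicalSpace.PseudoMetrizableSpace (E j)] [∀ j, MeasurableSpace (E j)]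
    [∀ j, BorelSpace (E j)] {X : ∀ i, ∀ j, Ω₁ i → E j} {Z : ∀ j, Ω' → E j}
    (hX : ∀ j, TendstoInDistribution (fun i => X i j) l (Z j) μ μ')
    (hXindep : ∀ᶠ i in l, iIndepFun (X i) (μ i)) (hZindep : iIndepFun Z μ') :
    TendstoInDistribution (fun i ω j => X i j ω) l (fun ω j => Z j ω) μ μ' := by
  cases nonempty_fintype κ
  refine ⟨fun i => aemeasurable_pi_iff.2 fun j => (hX j).forall_aemeasurable i,
    aemeasurable_pi_iff.2 fun j => (hX j).aemeasurable_limit, ?_⟩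
  have hpi := (ProbabilityMeasure.continuous_pi.tendsto _).comp
    (tendsto_pi_nhds.2 fun j => (hX j).tendsto)
  have hlim := (iIndepFun_iff_map_fun_eq_pi_map fun j => (hX j).aemeasurable_limit).1 hZindep
  simp only [hlim]
  refine hpi.congr' (hXindep.mono fun i hi => Subtype.ext ?_)
  exact ((iIndepFun_iff_map_fun_eq_pi_map fun j => (hX j).forall_aemeasurable i).1 hi).symm

end ConvergenceInDistribution

section DeltaMethod

variable {E F : Type*} [NormedAddCommGroup E] [NormedSpace ℝ E] [NormedAddCommGroup F]
  [NormedSpace ℝ F]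

/-- The difference quotient `s⁻¹ • (f (a + s • w) - f a)` of `f` at `a` as a function of `(w, s)`,
with the value `f' w` that it should have in the limit `s = 0`. -/
noncomputable def differenceQuotient (f : E → F) (f' : E →L[ℝ] F) (a : E) (p : E × ℝ) : F :=
  if p.2 = 0 then f' p.1 else p.2⁻¹ • (f (a + p.2 • p.1) - f a)

lemma continuous_differenceQuotient {f : E → F} {f' : E →L[ℝ] F} {a : E} (hf : Continuous f)
    (hf' : HasFDerivAt f f' a) : Continuous (differenceQuotient f f' a) := by
  refine continuous_iff_continuousAt.2 fun ⟨w₀, s₀⟩ => ?_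
  rcases ne_or_eq s₀ 0 with hs₀ | rfl
  · have hquot : ContinuousAt (fun p : E × ℝ => p.2⁻¹ • (f (a + p.2 • p.1) - f a)) (w₀, s₀) :=
      (continuousAt_snd.inv₀ hs₀).smul (by fun_prop)
    refine hquot.congr ?_
    filter_upwards [continuousAt_snd.eventually_ne hs₀] with p hp
    exact (if_neg hp).symm
  · have hsmul : Tendsto (fun p : E × ℝ => p.2 • p.1) (𝓝 (w₀, 0)) (𝓝 0) :=
      (continuous_snd.smul continuous_fst).tendsto' _ _ (zero_smul ℝ w₀)
    have hremainder : (fun p => differenceQuotient f f' a p - f' p.1) =o[𝓝 (w₀, 0)] Prod.fst := by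
      refine Asymptotics.IsLittleO.of_bound fun ε hε => ?_
      filter_upwards [((hasFDerivAt_iff_isLittleO_nhds_zero.1 hf').comp_tendsto hsmul).bound hε]
        with p hp
      by_cases hp0 : p.2 = 0
      · rw [differenceQuotient, if_pos hp0, sub_self, norm_zero]
        positivity
      · have hnorm : 0 < ‖p.2‖ := norm_pos_iff.2 hp0
        rw [differenceQuotient, if_neg hp0, ← inv_smul_smul₀ hp0 (f' p.1), ← smul_sub, norm_smul,
          norm_inv, inv_mul_le_iff₀ hnorm]
        simpa only [Function.comp_apply, map_smul, norm_smul, mul_left_comm] using hp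
    have hzero : Tendsto (fun p => differenceQuotient f f' a p - f' p.1) (𝓝 (w₀, 0)) (𝓝 0) :=
      (Asymptotics.isLittleO_one_iff ℝ).1 <| hremainder.trans_isBigO <|
        continuousAt_fst.isBigO_one ℝ
    have hlin : Tendsto (fun p : E × ℝ => f' p.1) (𝓝 (w₀, 0)) (𝓝 (f' w₀)) :=
      (f'.continuous.comp continuous_fst).tendsto (w₀, 0)
    rw [ContinuousAt, show differenceQuotient f f' a (w₀, 0) = 0 + f' w₀ by
      simp [differenceQuotient]]
    exact (hzero.add hlin).congr fun p => sub_add_cancel _ _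

theorem tendstoInDistribution_smul_sub_of_hasFDerivAt [SecondCountableTopology E]
    [MeasurableSpace E] [BorelSpace E] [MeasurableSpace F] [BorelSpace F]
    {ι Ω' : Type*} {Ω : ι → Type*} [∀ i, MeasurableSpace (Ω i)]
    {μ : ∀ i, Measure (Ω i)} [∀ i, IsProbabilityMeasure (μ i)]
    [MeasurableSpace Ω'] {μ' : Measure Ω'} [IsProbabilityMeasure μ'] {l : Filter ι}
    {f : E → F} {f' : E →L[ℝ] F} {a : E} (hf : Continuous f) (hf' : HasFDerivAt f f' a)
    {r : ι → ℝ} (hr : Tendsto r l atTop) {X : ∀ i, Ω i → E} {Z : Ω' → E}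
    (hX : TendstoInDistribution (fun i ω => r i • (X i ω - a)) l Z μ μ') :
    TendstoInDistribution (fun i ω => r i • (f (X i ω) - f a)) l (fun ω => f' (Z ω)) μ μ' := by
  have h := (tendstoInDistribution_prodMk_const hX
    (tendsto_inv_atTop_zero.comp hr)).continuous_comp (continuous_differenceQuotient hf hf')
  refine h.congr (fun i => .of_eq <| funext fun ω => ?_) (.of_eq <| funext fun ω => ?_)
  · by_cases hri : r i = 0
    · simp [differenceQuotient, hri]
    · simp [differenceQuotient, hri, smul_smul]
  · simp [differenceQuotient]

end DeltaMethod

section LatticePaths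

variable {R : Type*}

/-- The total weight of the lattice paths with steps `±1` that stay nonnegative and go from `0` to
`h` in `i` steps, where a step from `j + 1` down to `j` has weight `z j`. -/
def pathWeight [CommSemiring R] (z : ℕ → R) : ℕ → ℕ → R
  | 0, h => if h = 0 then 1 else 0
  | i + 1, 0 => z 0 * pathWeight z i 1
  | i + 1, h + 1 => pathWeight z i h + z (h + 1) * pathWeight z i (h + 2)

/-- The moments whose generating function has the Stieltjes continued fraction with coefficients
`z`, given by Flajolet's formula as the weights of the Dyck paths. -/
def stieltjesMoment [CommSemiring R] (z : ℕ → R) (i : ℕ) : R := pathWeight z (2 * i) 0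

/-- The number of walks on `ℤ` with `i` steps `±1` from `0` to `x`. -/
def walkCount : ℕ → ℤ → ℕ
  | 0, x => if x = 0 then 1 else 0
  | i + 1, x => walkCount i (x - 1) + walkCount i (x + 1)

section CommSemiring

variable [CommSemiring R]

lemma pathWeight_zero_zero (z : ℕ → R) : pathWeight z 0 0 = 1 := if_pos rfl

lemma pathWeight_zero_succ (z : ℕ → R) (h : ℕ) : pathWeight z 0 (h + 1) = 0 :=
  if_neg h.succ_ne_zero

lemma pathWeight_succ_zero (z : ℕ → R) (i : ℕ) :
    pathWeight z (i + 1) 0 = z 0 * pathWeight z i 1 := rfl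

lemma pathWeight_succ_succ (z : ℕ → R) (i h : ℕ) :
    pathWeight z (i + 1) (h + 1) = pathWeight z i h + z (h + 1) * pathWeight z i (h + 2) := rfl

lemma stieltjesMoment_zero (z : ℕ → R) : stieltjesMoment z 0 = 1 := pathWeight_zero_zero z

lemma pathWeight_eq_zero_of_lt (z : ℕ → R) {i h : ℕ} (hih : i < h) : pathWeight z i h = 0 := by
  induction i generalizing h with
  | zero =>
    obtain ⟨h, rfl⟩ := Nat.exists_eq_succ_of_ne_zero hih.ne'
    exact pathWeight_zero_succ z h
  | succ i ih =>
    obtain ⟨h, rfl⟩ := Nat.exists_eq_succ_of_ne_zero (Nat.ne_zero_of_lt hih)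
    rw [Nat.succ_eq_add_one, pathWeight_succ_succ, ih (by omega), ih (by omega), mul_zero, add_zero]

lemma pathWeight_self (z : ℕ → R) (i : ℕ) : pathWeight z i i = 1 := by
  induction i with
  | zero => exact pathWeight_zero_zero z
  | succ i ih =>
    rw [pathWeight_succ_succ, ih, pathWeight_eq_zero_of_lt z (by omega), mul_zero, add_zero]

lemma pathWeight_congr {z z' : ℕ → R} {i h : ℕ}
    (hz : ∀ j, 2 * (j + 1) ≤ i + h → z j = z' j) : pathWeight z i h = pathWeight z' i h := by
  induction i generalizing h with
  | zero => cases h <;> rfl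
  | succ i ih =>
    rcases h with _ | h
    · rw [pathWeight_succ_zero, pathWeight_succ_zero, ih fun j hj => hz j (by omega)]
      rcases i with _ | i
      · rw [pathWeight_zero_succ, mul_zero, mul_zero]
      · rw [hz 0 (by omega)]
    · rw [pathWeight_succ_succ, pathWeight_succ_succ, ih fun j hj => hz j (by omega),
        ih fun j hj => hz j (by omega)]
      rcases lt_or_ge i (h + 2) with hi | hi
      · rw [pathWeight_eq_zero_of_lt z' hi, mul_zero, mul_zero]
      · rw [hz (h + 1) (by omega)]

lemma stieltjesMoment_congr {z z' : ℕ → R} {i : ℕ} (hz : ∀ j < i, z j = z' j) :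
    stieltjesMoment z i = stieltjesMoment z' i :=
  pathWeight_congr fun j hj => hz j (by omega)

-- Exactly one of the paths from height `h` to `0` with `2 * k + 2 - h` steps reaches height
-- `k + 1`, namely the one that climbs first.
lemma pathWeight_eq_update_add_prod (z : ℕ → R) {k i h : ℕ} (hk : h ≤ k)
    (hih : i + h = 2 * (k + 1)) :
    pathWeight z i h =
      pathWeight (Function.update z k 0) i h + ∏ j ∈ Finset.Ico h (k + 1), z j := by
  induction i generalizing h with
  | zero => omega
  | succ i ih =>
    have hdown : z h * pathWeight z i (h + 1) =
        Function.update z k 0 h * pathWeight (Function.update z k 0) i (h + 1) +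
          ∏ j ∈ Finset.Ico h (k + 1), z j := by
      rw [Finset.prod_eq_prod_Ico_succ_bot (by omega)]
      rcases hk.eq_or_lt with rfl | hlt
      · obtain rfl : i = h + 1 := by omega
        simp [pathWeight_self]
      · rw [Function.update_of_ne hlt.ne, ih (by omega) (by omega), mul_add]
    rcases h with _ | h
    · exact hdown
    · rw [pathWeight_succ_succ, pathWeight_succ_succ, hdown, ← add_assoc,
        pathWeight_congr (z := z) (z' := Function.update z k 0) (h := h)]
      exact fun j hj => (Function.update_of_ne (by omega) _ _).symm

lemma stieltjesMoment_succ_eq (z : ℕ → R) (k : ℕ) :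
    stieltjesMoment z (k + 1) =
      stieltjesMoment (Function.update z k 0) (k + 1) + ∏ j ∈ Finset.range (k + 1), z j := by
  rw [Finset.range_eq_Ico]
  exact pathWeight_eq_update_add_prod z k.zero_le (by omega)

end CommSemiring

lemma walkCount_succ (i : ℕ) (x : ℤ) :
    walkCount (i + 1) x = walkCount i (x - 1) + walkCount i (x + 1) := rfl

lemma walkCount_neg (i : ℕ) (x : ℤ) : walkCount i (-x) = walkCount i x := by
  induction i generalizing x with
  | zero => simp [walkCount]
  | succ i ih =>
    rw [walkCount_succ, walkCount_succ, ← ih (-x - 1), ← ih (-x + 1), add_comm]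
    congr 2 <;> ring

lemma walkCount_eq_zero_of_lt {i : ℕ} {x : ℤ} (hx : (i : ℤ) < x) : walkCount i x = 0 := by
  induction i generalizing x with
  | zero => exact if_neg (by omega)
  | succ i ih => rw [walkCount_succ, ih (by omega), ih (by omega)]

lemma walkCount_sub_two_mul (i r : ℕ) : walkCount i (i - 2 * r) = i.choose r := by
  induction i generalizing r with
  | zero =>
    rcases r with _ | r
    · simp [walkCount]
    · exact if_neg (by omega)
  | succ i ih =>
    rw [walkCount_succ]
    rcases r with _ | r
    · rw [walkCount_eq_zero_of_lt (x := _ + 1) (by omega)]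
      simpa using ih 0
    · rw [Nat.choose_succ_succ, ← ih, ← ih, add_comm]
      congr 2 <;> push_cast <;> ring

-- The reflection principle: the walks that reach height `-1` correspond to those ending at
-- `-h - 2`.
lemma pathWeight_one [CommRing R] (i h : ℕ) :
    pathWeight (fun _ => (1 : R)) i h = walkCount i h - walkCount i (h + 2) := by
  induction i generalizing h with
  | zero =>
    have hne : (h : ℤ) + 2 ≠ 0 := by omega
    simp [pathWeight, walkCount, hne]
  | succ i ih =>
    rcases h with _ | h
    · simp only [pathWeight_succ_zero, ih, walkCount_succ, Nat.cast_zero, zero_sub, zero_add,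
        walkCount_neg, Nat.cast_add, Nat.cast_one, one_mul]
      norm_num
    · simp only [pathWeight_succ_succ, ih, walkCount_succ]
      push_cast
      ring_nf

lemma stieltjesMoment_one (i : ℕ) :
    stieltjesMoment (fun _ => (1 : ℝ)) (i + 1) = catalan (i + 1) := by
  have hzero : walkCount (2 * (i + 1)) 0 = (2 * (i + 1)).choose (i + 1) := by
    rw [← walkCount_sub_two_mul]
    congr 1
    push_cast
    ring
  have htwo : walkCount (2 * (i + 1)) 2 = (2 * (i + 1)).choose i := by
    rw [← walkCount_sub_two_mul]
    congr 1
    push_cast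
    ring
  have hcatalan : ((i : ℝ) + 2) * catalan (i + 1) = (2 * (i + 1)).choose (i + 1) := by
    rw [← Nat.centralBinom, ← succ_mul_catalan_eq_centralBinom]
    push_cast
    ring
  have hchoose : ((2 * (i + 1)).choose (i + 1) : ℝ) * (i + 1) =
      (2 * (i + 1)).choose i * (i + 2) := by
    have hnat := Nat.choose_succ_right_eq (2 * (i + 1)) i
    rw [show 2 * (i + 1) - i = i + 2 by omega] at hnat
    exact_mod_cast hnat
  rw [stieltjesMoment, pathWeight_one, Nat.cast_zero, zero_add, hzero, htwo]
  refine mul_left_cancel₀ (show (i : ℝ) + 2 ≠ 0 by positivity) ?_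
  linarith

lemma walkCount_succ_add_abs (i : ℕ) (c x : ℤ) :
    (walkCount (i + 1) (c + |x|) : ℝ) = walkCount i (c + |x - 1|) + walkCount i (c + |x + 1|) +
      if x = 0 then (walkCount i (c - 1) - walkCount i (c + 1) : ℝ) else 0 := by
  rw [walkCount_succ, Nat.cast_add]
  rcases lt_trichotomy x 0 with hx | rfl | hx
  · rw [if_neg hx.ne, abs_of_neg hx, abs_of_neg (by omega), abs_of_nonpos (by omega : x + 1 ≤ 0),
      add_zero, add_comm]
    congr 3 <;> ring
  · simp [add_comm]
  · rw [if_neg hx.ne', abs_of_pos hx, abs_of_nonneg (by omega), abs_of_pos (by omega : 0 < x + 1),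
      add_zero]
    congr 3 <;> ring

-- The derivative counts the paths with a marked step from `j + 1` down to `j`; reflection turns
-- these into walks with a shifted end point.
lemma hasDerivAt_pathWeight_update_one (j i h : ℕ) :
    HasDerivAt (fun t : ℝ => pathWeight (Function.update (fun _ => 1) j t) i h)
      (walkCount i (j + 2 + |(j : ℤ) - h|) - walkCount i (2 * j + h + 4)) 1 := by
  have hself : Function.update (fun _ => (1 : ℝ)) j 1 = fun _ => 1 := Function.update_eq_self j _
  have hweight (g : ℕ) : HasDerivAt (fun t : ℝ => Function.update (fun _ => (1 : ℝ)) j t g)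
      (if j = g then 1 else 0) 1 := by
    rcases eq_or_ne j g with rfl | hjg
    · simpa using hasDerivAt_id' (1 : ℝ)
    · simpa [hjg, hjg.symm] using hasDerivAt_const (1 : ℝ) (1 : ℝ)
  induction i generalizing h with
  | zero =>
    rw [walkCount, walkCount, if_neg (by positivity), if_neg (by positivity)]
    exact (hasDerivAt_const (1 : ℝ) _).congr_deriv (by simp)
  | succ i ih =>
    rw [walkCount_succ_add_abs, walkCount_succ]
    rcases h with _ | h
    · refine ((hweight 0).mul (ih 1)).congr_deriv ?_
      rw [hself, pathWeight_one]
      rcases eq_or_ne j 0 with rfl | hj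
      · norm_num
      · rw [if_neg hj, if_neg (by simpa using hj),
          abs_of_nonneg (by omega : (0 : ℤ) ≤ j - (0 : ℕ) + 1)]
        push_cast
        ring_nf
    · refine ((ih h).add ((hweight (h + 1)).mul (ih (h + 2)))).congr_deriv ?_
      rw [hself, pathWeight_one]
      rcases eq_or_ne j (h + 1) with rfl | hj
      · simp only [Nat.cast_add, Nat.cast_one, Nat.cast_ofNat, add_sub_cancel_left, abs_one,
          if_true, add_sub_add_left_eq_sub, sub_self, one_mul, zero_add]
        ring_nf
      · rw [if_neg hj, if_neg (by omega)]
        push_cast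
        ring_nf

lemma hasDerivAt_stieltjesMoment_update_one {k : ℕ} (i j : Fin k) :
    HasDerivAt (fun t : ℝ => stieltjesMoment (Function.update (fun _ => 1) j t) (i + 1))
      (matrixC k i j) 1 := by
  refine (hasDerivAt_pathWeight_update_one j (2 * (i + 1)) 0).congr_deriv ?_
  have hwalk (r : ℕ) (x : ℤ) (hx : x = 2 * ((i : ℤ) + 1) - 2 * r) :
      walkCount (2 * (i + 1)) x = (2 * ((i : ℕ) + 1)).choose r := by
    rw [← walkCount_sub_two_mul, hx]
    push_cast
    rfl
  rw [Nat.cast_zero, sub_zero, abs_of_nonneg (by positivity), matrixC]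
  split_ifs with hij hlt
  · subst hij
    rw [hwalk 0 _ (by push_cast; ring), walkCount_eq_zero_of_lt (by push_cast; omega)]
    simp
  · rw [hwalk (i - j) _ (by omega), hwalk (i - j - 1) _ (by omega)]
  · rw [walkCount_eq_zero_of_lt (by push_cast; omega),
      walkCount_eq_zero_of_lt (by push_cast; omega), sub_self]

end LatticePaths

section JacobiMatrix

open Matrix

lemma exists_isProbabilityMeasure_integral_pow_eq {ι : Type*} [Fintype ι] [DecidableEq ι]
    {A : Matrix ι ι ℝ} (hA : A.IsHermitian) (a : ι) :
    ∃ μ : Measure ℝ, IsProbabilityMeasure μ ∧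
      ∀ i : ℕ, Integrable (fun x => x ^ i) μ ∧ ∫ x, x ^ i ∂μ = (A ^ i) a a := by
  obtain ⟨U, hU⟩ : ∃ U : Matrix ι ι ℝ, U = hA.eigenvectorUnitary := ⟨_, rfl⟩
  have hpow (i : ℕ) : (A ^ i) a a = ∑ j, U a j ^ 2 * hA.eigenvalues j ^ i := by
    conv_lhs => rw [hA.spectral_theorem, ← map_pow, Unitary.conjStarAlgAut_apply, diagonal_pow,
      mul_apply]
    refine Finset.sum_congr rfl fun j _ => ?_
    simp only [mul_diagonal, star_apply, star_trivial, Pi.pow_apply, Function.comp_apply,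
      RCLike.ofReal_real_eq_id, id, hU]
    ring
  have hint (i : ℕ) (j : ι) : Integrable (fun x : ℝ => x ^ i)
      (ENNReal.ofReal (U a j ^ 2) • Measure.dirac (hA.eigenvalues j)) :=
    (integrable_dirac (by simp)).smul_measure ENNReal.ofReal_ne_top
  refine ⟨∑ j, ENNReal.ofReal (U a j ^ 2) • Measure.dirac (hA.eigenvalues j), ⟨?_⟩, fun i =>
    ⟨integrable_finsetSum_measure.2 fun j _ => hint i j, ?_⟩⟩
  · have hone := hpow 0
    simp only [pow_zero, one_apply_eq, mul_one] at hone
    simp only [Measure.coe_finsetSum, Finset.sum_apply, Measure.smul_apply, measure_univ,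
      smul_eq_mul, mul_one]
    rw [← ENNReal.ofReal_sum_of_nonneg fun j _ => sq_nonneg _, ← hone, ENNReal.ofReal_one]
  · rw [integral_finsetSum_measure fun j _ => hint i j, hpow]
    refine Finset.sum_congr rfl fun j _ => ?_
    rw [integral_smul_measure, integral_dirac, ENNReal.toReal_ofReal (sq_nonneg _), smul_eq_mul]

lemma eval_charpoly_sq_of_mul_eq_neg_mul {ι R : Type*} [Fintype ι] [DecidableEq ι] [CommRing R]
    {M S : Matrix ι ι R} (hS : S * S = 1) (hSM : S * M = -(M * S)) (x : R) :
    (M ^ 2).charpoly.eval (x ^ 2) = M.charpoly.eval x ^ 2 := by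
  have hfactor : scalar ι (x ^ 2) - M ^ 2 = (scalar ι x - M) * (scalar ι x + M) := by
    rw [map_pow, sq, sq, (scalar_commute x (Commute.all x) M).mul_self_sub_mul_self_eq']
  have hconj : S * (scalar ι x - M) * S = scalar ι x + M := by
    rw [mul_sub, sub_mul, hSM, ← (scalar_commute x (Commute.all x) S).eq, mul_assoc, hS, neg_mul,
      mul_assoc, hS, mul_one, mul_one, sub_neg_eq_add]
  have hdet : (scalar ι x + M).det = (scalar ι x - M).det := by
    rw [← hconj, det_mul, det_mul, mul_right_comm, ← det_mul, hS, det_one, one_mul]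
  rw [eval_charpoly, eval_charpoly, hfactor, det_mul, hdet, sq]

/-- The Jacobi matrix with zero diagonal and off-diagonal entries `√(z j)`. -/
noncomputable def jacobiMatrix (z : ℕ → ℝ) (k : ℕ) : Matrix (Fin (k + 1)) (Fin (k + 1)) ℝ :=
  fun a b => (if (b : ℕ) = a + 1 then √(z a) else 0) + if (a : ℕ) = b + 1 then √(z b) else 0

variable {z : ℕ → ℝ} {k : ℕ}

lemma isHermitian_jacobiMatrix (z : ℕ → ℝ) (k : ℕ) : (jacobiMatrix z k).IsHermitian :=
  Matrix.ext fun _ _ => add_comm _ _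

lemma jacobiMatrix_mulVec (z : ℕ → ℝ) {v : ℕ → ℝ} (hv : v (k + 1) = 0) (a : Fin (k + 1)) :
    (jacobiMatrix z k *ᵥ fun b => v b) a =
      √(z a) * v (a + 1) + if (a : ℕ) = 0 then 0 else √(z (a - 1)) * v (a - 1) := by
  simp only [mulVec, dotProduct, jacobiMatrix, add_mul, ite_mul, zero_mul, Finset.sum_add_distrib]
  congr 1
  · rw [← Finset.sum_range fun b => if b = (a : ℕ) + 1 then √(z a) * v b else 0,
      Finset.sum_ite_eq']
    split_ifs with ha
    · rfl
    · rw [Finset.mem_range] at ha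
      rw [show (a : ℕ) + 1 = k + 1 by omega, hv, mul_zero]
  · rw [← Finset.sum_range fun b => if (a : ℕ) = b + 1 then √(z b) * v b else 0]
    rcases a with ⟨_ | a, ha⟩
    · simp
    · simp [show a < k + 1 by omega]

-- Conjugation by the diagonal matrix of the square roots of the products of the `z j` turns the
-- Jacobi matrix into the transfer matrix of the path weights.
lemma jacobiMatrix_pow_mulVec_single (hz : ∀ j, 0 ≤ z j) (hzk : z k = 0) (i : ℕ) :
    jacobiMatrix z k ^ i *ᵥ Pi.single 0 1 =
      fun a : Fin (k + 1) => √(∏ j ∈ Finset.range a, z j) * pathWeight z i a := by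
  have hnonneg (g : ℕ) : 0 ≤ ∏ j ∈ Finset.range g, z j := Finset.prod_nonneg fun j _ => hz j
  have hsqrt (g : ℕ) : √(z g) * √(∏ j ∈ Finset.range (g + 1), z j) =
      √(∏ j ∈ Finset.range g, z j) * z g := by
    rw [Finset.prod_range_succ, Real.sqrt_mul (hnonneg g), mul_left_comm, Real.mul_self_sqrt (hz g)]
  induction i with
  | zero =>
    ext ⟨a, ha⟩
    rw [pow_zero, one_mulVec]
    cases a <;> simp [pathWeight, Fin.ext_iff]
  | succ i ih =>
    ext ⟨a, ha⟩
    rw [pow_succ', ← mulVec_mulVec, ih,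
      jacobiMatrix_mulVec z (v := fun a => √(∏ j ∈ Finset.range a, z j) * pathWeight z i a)
        (by simp [Finset.prod_range_succ, hzk])]
    rcases a with _ | a
    · simp only [← mul_assoc, hsqrt, if_true, add_zero, pathWeight_succ_zero]
    · rw [if_neg (by simp), Nat.add_sub_cancel, ← mul_assoc, hsqrt, ← mul_assoc,
        Finset.prod_range_succ, Real.sqrt_mul (hnonneg a), pathWeight_succ_succ]
      ring

lemma jacobiMatrix_pow_two_mul_apply_zero (hz : ∀ j, 0 ≤ z j) (hzk : z k = 0) (i : ℕ) :
    (jacobiMatrix z k ^ (2 * i)) 0 0 = stieltjesMoment z i := by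
  have h := congrFun (jacobiMatrix_pow_mulVec_single hz hzk (2 * i)) 0
  rw [stieltjesMoment]
  simpa only [mulVec_single_one, col_apply, Fin.val_zero, Finset.range_zero, Finset.prod_empty,
    Real.sqrt_one, one_mul] using h

-- Conjugation by the signs `(-1) ^ a` changes the Jacobi matrix into its negative.
lemma eval_charpoly_jacobiMatrix_sq (z : ℕ → ℝ) (k : ℕ) (x : ℝ) :
    (jacobiMatrix z k ^ 2).charpoly.eval (x ^ 2) = (jacobiMatrix z k).charpoly.eval x ^ 2 := by
  refine eval_charpoly_sq_of_mul_eq_neg_mul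
    (S := diagonal fun a : Fin (k + 1) => (-1) ^ (a : ℕ)) ?_ ?_ x
  · rw [diagonal_mul_diagonal, ← diagonal_one]
    simp [← mul_pow]
  · ext a b
    rw [neg_apply, diagonal_mul, mul_diagonal, jacobiMatrix]
    split_ifs with hba hab hab
    · omega
    · rw [hba, pow_succ]
      ring
    · rw [hab, pow_succ]
      ring
    · simp

lemma sum_coeff_charpoly_jacobiMatrix_sq_mul (hz : ∀ j, 0 ≤ z j) (hzk : z k = 0) :
    ∑ i ∈ Finset.range (k + 2),
      (jacobiMatrix z k ^ 2).charpoly.coeff i * stieltjesMoment z i = 0 := by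
  have h := congrFun₂ (aeval_self_charpoly (jacobiMatrix z k ^ 2)) 0 0
  rw [Polynomial.aeval_eq_sum_range, charpoly_natDegree_eq_dim, Fintype.card_fin,
    Matrix.sum_apply] at h
  simpa only [Matrix.smul_apply, ← pow_mul, jacobiMatrix_pow_two_mul_apply_zero hz hzk,
    smul_eq_mul, Matrix.zero_apply] using h

end JacobiMatrix

section LowerMoment

variable {z c : ℕ → ℝ} {k : ℕ}

lemma HasMoments.congr {μ : Measure ℝ} {c' : ℕ → ℝ} (h : HasMoments μ k c)
    (hc : ∀ i ∈ Finset.Icc 1 k, c i = c' i) : HasMoments μ k c' :=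
  ⟨h.1, h.2.1, fun i hi => (h.2.2 i hi).imp_right (·.trans (hc i hi))⟩

lemma exists_hasMoments_stieltjesMoment (hz : ∀ j, 0 ≤ z j) (hzk : z k = 0) (n : ℕ) :
    ∃ μ : Measure ℝ, HasMoments μ n (stieltjesMoment z) := by
  obtain ⟨μ, hμ, hmom⟩ :=
    exists_isProbabilityMeasure_integral_pow_eq (isHermitian_jacobiMatrix z k) 0
  have hsq : AEMeasurable (fun x : ℝ => x ^ 2) μ := by fun_prop
  refine ⟨μ.map fun x => x ^ 2, Measure.isProbabilityMeasure_map hsq, ?_, fun i _ => ?_⟩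
  · rw [Measure.map_apply_of_aemeasurable hsq measurableSet_Iio]
    convert measure_empty (μ := μ)
    ext x
    simp [sq_nonneg]
  · rw [integrable_map_measure (by fun_prop) hsq, integral_map hsq (by fun_prop)]
    simp only [Function.comp_def, ← pow_mul, hmom, and_true,
      jacobiMatrix_pow_two_mul_apply_zero hz hzk]

lemma integral_eval_eq_sum_coeff_mul {μ : Measure ℝ} {p : Polynomial ℝ}
    (hμ : ∀ i ≤ p.natDegree, Integrable (fun x => x ^ i) μ) :
    ∫ x, p.eval x ∂μ = ∑ i ∈ Finset.range (p.natDegree + 1), p.coeff i * ∫ x, x ^ i ∂μ := by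
  simp only [Polynomial.eval_eq_sum_range, ← integral_const_mul]
  exact integral_finsetSum _ fun i hi =>
    (hμ i (Nat.lt_succ_iff.1 (Finset.mem_range.1 hi))).const_mul _

-- The characteristic polynomial of the squared Jacobi matrix is monic and nonnegative on `[0, ∞)`,
-- so its integral against `μ` bounds the top moment by the lower ones; by Cayley–Hamilton the bound
-- is attained by `stieltjesMoment z`.
lemma stieltjesMoment_succ_le_integral (hz : ∀ j, 0 ≤ z j) (hzk : z k = 0) {μ : Measure ℝ}
    (hμ : HasMoments μ k (stieltjesMoment z)) (hint : Integrable (fun x : ℝ => x ^ (k + 1)) μ) :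
    stieltjesMoment z (k + 1) ≤ ∫ x, x ^ (k + 1) ∂μ := by
  obtain ⟨hprob, hneg, hmom⟩ := hμ
  obtain ⟨p, hp⟩ : ∃ p, p = (jacobiMatrix z k ^ 2).charpoly := ⟨_, rfl⟩
  have hdeg : p.natDegree = k + 1 := by rw [hp, Matrix.charpoly_natDegree_eq_dim, Fintype.card_fin]
  have hlead : p.coeff (k + 1) = 1 := by
    rw [← hdeg, hp]
    exact (Matrix.charpoly_monic _).coeff_natDegree
  have hlower (i : ℕ) (hi : i < k + 1) :
      Integrable (fun x => x ^ i) μ ∧ ∫ x, x ^ i ∂μ = stieltjesMoment z i := by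
    rcases i.eq_zero_or_pos with rfl | hpos
    · simp [stieltjesMoment_zero]
    · exact hmom i (Finset.mem_Icc.2 ⟨hpos, Nat.lt_succ_iff.1 hi⟩)
  have heval : 0 ≤ ∫ x, p.eval x ∂μ := by
    have hpos : ∀ᵐ x ∂μ, 0 ≤ x := by
      simpa only [ae_iff, not_le, Set.Iio_def] using hneg
    refine integral_nonneg_of_ae (hpos.mono fun x hx => ?_)
    have heval_sq := eval_charpoly_jacobiMatrix_sq z k √x
    rw [Real.sq_sqrt hx, ← hp] at heval_sq
    exact (sq_nonneg _).trans_eq heval_sq.symm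
  have hsum := sum_coeff_charpoly_jacobiMatrix_sq_mul hz hzk
  rw [← hp, Finset.sum_range_succ, hlead] at hsum
  rw [integral_eval_eq_sum_coeff_mul, hdeg, Finset.sum_range_succ, hlead,
    Finset.sum_congr rfl fun i hi => by rw [(hlower i (Finset.mem_range.1 hi)).2]] at heval
  · linarith
  · intro i hi
    rcases (hi.trans_eq hdeg).eq_or_lt with rfl | hlt
    exacts [hint, (hlower i hlt).1]

lemma lowerMoment_succ_eq (hz : ∀ j < k, 0 ≤ z j) (hc : ∀ i ≤ k, c i = stieltjesMoment z i) :
    lowerMoment c (k + 1) = stieltjesMoment (Function.update z k 0) (k + 1) := by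
  obtain ⟨z', hz'⟩ : ∃ z' : ℕ → ℝ, ∀ j, z' j = if j < k then z j else 0 := ⟨_, fun _ => rfl⟩
  have hnonneg (j : ℕ) : 0 ≤ z' j := by
    rw [hz']
    split_ifs with hj
    exacts [hz j hj, le_rfl]
  have hzk : z' k = 0 := by simp [hz']
  have hupdate : stieltjesMoment (Function.update z k 0) (k + 1) = stieltjesMoment z' (k + 1) := by
    refine stieltjesMoment_congr fun j hj => ?_
    rcases (Nat.lt_succ_iff.1 hj).eq_or_lt with rfl | hlt
    · rw [Function.update_self, hzk]
    · rw [Function.update_of_ne hlt.ne, hz', if_pos hlt]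
  have hc' (i : ℕ) (hi : i ∈ Finset.Icc 1 k) : c i = stieltjesMoment z' i := by
    rw [hc i (Finset.mem_Icc.1 hi).2]
    refine stieltjesMoment_congr fun j hj => ?_
    rw [hz', if_pos (hj.trans_le (Finset.mem_Icc.1 hi).2)]
  obtain ⟨μ, hμ⟩ := exists_hasMoments_stieltjesMoment hnonneg hzk (k + 1)
  rw [hupdate, lowerMoment]
  refine IsLeast.csInf_eq ⟨⟨μ, ⟨hμ.1, hμ.2.1, fun i hi => ?_⟩, hμ.2.2 (k + 1) (by simp)⟩, ?_⟩
  · rw [hc' i hi]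
    exact hμ.2.2 i (Finset.Icc_subset_Icc_right k.le_succ hi)
  · rintro y ⟨ν, hν, hνint, rfl⟩
    exact stieltjesMoment_succ_le_integral hnonneg hzk (hν.congr hc') hνint

lemma sub_lowerMoment_eq_prod (hz : ∀ j < k, 0 ≤ z j) (hc : ∀ i ≤ k, c i = stieltjesMoment z i) :
    c k - lowerMoment c k = ∏ j ∈ Finset.range k, z j := by
  rcases k with _ | k
  · rw [hc 0 le_rfl, stieltjesMoment_zero, lowerMoment, sub_zero, Finset.prod_range_zero]
  · rw [lowerMoment_succ_eq (fun j hj => hz j (by omega)) fun i hi => hc i (by omega), hc _ le_rfl,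
      stieltjesMoment_succ_eq, add_sub_cancel_left]

lemma recursionVar_succ_eq (hz : ∀ j ≤ k, 0 < z j) (hc : ∀ i ≤ k + 1, c i = stieltjesMoment z i) :
    recursionVar c (k + 1) = z k := by
  rw [recursionVar, Nat.add_sub_cancel,
    sub_lowerMoment_eq_prod (fun j hj => (hz j (by omega)).le) hc,
    sub_lowerMoment_eq_prod (fun j hj => (hz j (by omega)).le) fun i hi => hc i (by omega),
    Finset.prod_range_succ, mul_div_cancel_left₀]
  exact (Finset.prod_pos fun j hj => hz j (Finset.mem_range.1 hj).le).ne'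

lemma recursionVar_pos_and_eq_stieltjesMoment {n : ℕ} (h0 : c 0 = 1)
    (hc : ∀ k ∈ Finset.Icc 1 n, lowerMoment c k < c k) :
    (∀ j < n, 0 < recursionVar c (j + 1)) ∧
      ∀ i ≤ n, c i = stieltjesMoment (fun j => recursionVar c (j + 1)) i := by
  induction n with
  | zero => exact ⟨by simp, fun i hi => by rw [Nat.le_zero.1 hi, h0, stieltjesMoment_zero]⟩
  | succ n ih =>
    obtain ⟨hpos, heq⟩ := ih fun k hk => hc k (Finset.Icc_subset_Icc_right n.le_succ hk)
    have hprod := sub_lowerMoment_eq_prod (fun j hj => (hpos j hj).le) heq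
    have hprod_pos : 0 < c n - lowerMoment c n := by
      rw [hprod]
      exact Finset.prod_pos fun j hj => hpos j (Finset.mem_range.1 hj)
    have hpos_n : 0 < recursionVar c (n + 1) :=
      div_pos (sub_pos.2 (hc (n + 1) (by simp))) hprod_pos
    refine ⟨fun j hj => ?_, fun i hi => ?_⟩
    · rcases (Nat.lt_succ_iff.1 hj).eq_or_lt with rfl | hlt
      exacts [hpos_n, hpos j hlt]
    · rcases hi.eq_or_lt with rfl | hlt
      · rw [stieltjesMoment_succ_eq, ← lowerMoment_succ_eq (fun j hj => (hpos j hj).le) heq,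
          Finset.prod_range_succ, ← hprod, recursionVar, Nat.add_sub_cancel,
          mul_div_cancel₀ _ hprod_pos.ne', add_sub_cancel]
      · exact heq i (Nat.lt_succ_iff.1 hlt)

end LowerMoment

section StieltjesMap

variable {n : ℕ} {z : Fin n → ℝ}

/-- The sequence that continues a vector with coordinates `0, …, n - 1` by zeros. -/
noncomputable def zeroExtend (z : Fin n → ℝ) (j : ℕ) : ℝ := if h : j < n then z ⟨j, h⟩ else 0

/-- The map from the canonical coordinates `z₁, …, zₙ`, stored with indices `0, …, n - 1`, to the
moments `m₁, …, mₙ`. -/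
noncomputable def stieltjesMap (n : ℕ) (z : Fin n → ℝ) : Fin n → ℝ :=
  fun i => stieltjesMoment (zeroExtend z) (i + 1)

lemma zeroExtend_of_lt (z : Fin n → ℝ) {j : ℕ} (hj : j < n) : zeroExtend z j = z ⟨j, hj⟩ :=
  dif_pos hj

lemma zeroExtend_of_le (z : Fin n → ℝ) {j : ℕ} (hj : n ≤ j) : zeroExtend z j = 0 :=
  dif_neg hj.not_gt

lemma zeroExtend_val (z : Fin n → ℝ) (i : Fin n) : zeroExtend z i = z i := zeroExtend_of_lt z i.2

lemma zeroExtend_pos (hz : ∀ i, 0 < z i) {j : ℕ} (hj : j < n) : 0 < zeroExtend z j := by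
  rw [zeroExtend_of_lt z hj]
  exact hz _

lemma zeroExtend_nonneg (hz : ∀ i, 0 ≤ z i) (j : ℕ) : 0 ≤ zeroExtend z j := by
  rw [zeroExtend]
  split_ifs
  exacts [hz _, le_rfl]

lemma zeroExtend_update (z : Fin n → ℝ) (j : Fin n) (t : ℝ) :
    zeroExtend (Function.update z j t) = Function.update (zeroExtend z) j t := by
  ext k
  by_cases hk : k < n
  · simp [zeroExtend, hk, Function.update_apply, Fin.ext_iff]
  · rw [Function.update_of_ne (by omega), zeroExtend_of_le _ (by omega),
      zeroExtend_of_le _ (by omega)]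

lemma momentSeq_stieltjesMap (z : Fin n → ℝ) {i : ℕ} (hi : i ≤ n) :
    momentSeq (stieltjesMap n z) i = stieltjesMoment (zeroExtend z) i := by
  rcases i with _ | i
  · rw [stieltjesMoment_zero, momentSeq]
  · rw [momentSeq, dif_pos (Nat.lt_of_succ_le hi), stieltjesMap]

lemma recursionVar_stieltjesMap (hz : ∀ i, 0 < z i) (i : Fin n) :
    recursionVar (momentSeq (stieltjesMap n z)) (i + 1) = z i := by
  rw [recursionVar_succ_eq (z := zeroExtend z) (fun j hj => zeroExtend_pos hz (by omega))
    fun j hj => momentSeq_stieltjesMap z (by omega), zeroExtend_val]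

lemma lowerMoment_stieltjesMap_lt (hz : ∀ i, 0 < z i) {k : ℕ} (hk : k ≤ n) :
    lowerMoment (momentSeq (stieltjesMap n z)) k < momentSeq (stieltjesMap n z) k := by
  rw [← sub_pos, sub_lowerMoment_eq_prod (z := zeroExtend z)
    (fun j hj => (zeroExtend_pos hz (by omega)).le) fun j hj => momentSeq_stieltjesMap z (by omega)]
  exact Finset.prod_pos fun j hj => zeroExtend_pos hz ((Finset.mem_range.1 hj).trans_le hk)

lemma stieltjesMap_mem_momentSpace (hz : ∀ i, 0 ≤ z i) : stieltjesMap n z ∈ momentSpace n := by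
  obtain ⟨μ, hμ⟩ :=
    exists_hasMoments_stieltjesMoment (zeroExtend_nonneg hz) (zeroExtend_of_le z le_rfl) n
  exact ⟨μ, hμ.congr fun i hi => (momentSeq_stieltjesMap z (Finset.mem_Icc.1 hi).2).symm⟩

lemma injOn_stieltjesMap (n : ℕ) : Set.InjOn (stieltjesMap n) {z | ∀ i, 0 < z i} := by
  intro z hz z' hz' h
  ext i
  rw [← recursionVar_stieltjesMap hz, h, recursionVar_stieltjesMap hz']

lemma exists_stieltjesMap_eq {m : Fin n → ℝ}
    (hm : ∀ k ∈ Finset.Icc 1 n, lowerMoment (momentSeq m) k < momentSeq m k) :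
    ∃ z : Fin n → ℝ, (∀ i, 0 < z i) ∧ stieltjesMap n z = m := by
  obtain ⟨hpos, hmoment⟩ := recursionVar_pos_and_eq_stieltjesMoment (c := momentSeq m) rfl hm
  refine ⟨fun i => recursionVar (momentSeq m) (i + 1), fun i => hpos i i.2, funext fun i => ?_⟩
  have hmi := hmoment (i + 1) i.2
  rw [momentSeq, dif_pos i.2] at hmi
  rw [stieltjesMap, hmi]
  exact stieltjesMoment_congr fun j hj => zeroExtend_of_lt _ (by omega)

lemma firstCoords_stieltjesMap {k : ℕ} (hk : k ≤ n) (z : Fin n → ℝ) :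
    firstCoords k (stieltjesMap n z) = stieltjesMap k (firstCoords k z) := by
  ext i
  rw [firstCoords, dif_pos (i.2.trans_le hk), stieltjesMap, stieltjesMap]
  refine stieltjesMoment_congr fun j hj => ?_
  have hjk : j < k := (Nat.lt_succ_iff.1 hj).trans_lt i.2
  rw [zeroExtend_of_lt _ hjk, zeroExtend_of_lt _ (hjk.trans_le hk), firstCoords, dif_pos]

lemma stieltjesMap_one (i : Fin n) : stieltjesMap n 1 i = catalan (i + 1) := by
  rw [← stieltjesMoment_one, stieltjesMap]
  exact stieltjesMoment_congr fun j hj => zeroExtend_of_lt 1 (by omega)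

section Derivative

lemma differentiable_zeroExtend (n j : ℕ) :
    Differentiable ℝ fun z : Fin n → ℝ => zeroExtend z j := by
  by_cases hj : j < n
  · simp only [zeroExtend_of_lt _ hj]
    fun_prop
  · simp only [zeroExtend_of_le _ (not_lt.1 hj)]
    fun_prop

lemma differentiable_pathWeight_zeroExtend (n i h : ℕ) :
    Differentiable ℝ fun z : Fin n → ℝ => pathWeight (zeroExtend z) i h := by
  induction i generalizing h with
  | zero => exact differentiable_const _
  | succ i ih =>
    rcases h with _ | h
    · exact (differentiable_zeroExtend n 0).mul (ih 1)
    · exact (ih h).add ((differentiable_zeroExtend n (h + 1)).mul (ih (h + 2)))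

lemma differentiable_stieltjesMap (n : ℕ) : Differentiable ℝ (stieltjesMap n) :=
  differentiable_pi.2 fun _ => differentiable_pathWeight_zeroExtend n _ _

lemma hasDerivAt_stieltjesMap_update (z : Fin n → ℝ) (i j : Fin n) :
    HasDerivAt (fun t => stieltjesMap n (Function.update z j t) i)
      (fderiv ℝ (stieltjesMap n) z (Pi.single j 1) i) (z j) := by
  have h := (differentiable_stieltjesMap n (Function.update z j (z j))).hasFDerivAt.comp_hasDerivAt
    (z j) (hasDerivAt_update z j (z j))
  rw [Function.update_eq_self] at h
  exact hasDerivAt_pi.1 h i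

lemma fderiv_stieltjesMap_of_lt (z : Fin n → ℝ) {i j : Fin n} (hij : i < j) :
    fderiv ℝ (stieltjesMap n) z (Pi.single j 1) i = 0 := by
  refine (hasDerivAt_stieltjesMap_update z i j).unique
    ((hasDerivAt_const (z j) (stieltjesMap n z i)).congr_of_eventuallyEq (.of_forall fun t => ?_))
  refine stieltjesMoment_congr fun l hl => ?_
  have hlj : l ≠ j := ((Nat.lt_succ_iff.1 hl).trans_lt hij).ne
  rw [zeroExtend_update, Function.update_of_ne hlj]

lemma fderiv_stieltjesMap_self (z : Fin n → ℝ) (i : Fin n) :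
    fderiv ℝ (stieltjesMap n) z (Pi.single i 1) i = ∏ j ∈ Finset.range i, zeroExtend z j := by
  have hlinear := ((hasDerivAt_id (z i)).const_mul (∏ j ∈ Finset.range i, zeroExtend z j)).const_add
    (stieltjesMoment (Function.update (zeroExtend z) i 0) (i + 1))
  rw [mul_one] at hlinear
  refine (hasDerivAt_stieltjesMap_update z i i).unique
    (hlinear.congr_of_eventuallyEq (.of_forall fun t => ?_))
  have hprod : ∏ j ∈ Finset.range i, Function.update (zeroExtend z) i t j =
      ∏ j ∈ Finset.range i, zeroExtend z j :=
    Finset.prod_congr rfl fun j hj => Function.update_of_ne (Finset.mem_range.1 hj).ne _ _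
  change stieltjesMap n (Function.update z i t) i = _
  rw [stieltjesMap, zeroExtend_update, stieltjesMoment_succ_eq, Function.update_idem,
    Finset.prod_range_succ, Function.update_self, hprod]
  rfl

lemma prod_range_prod_range {M : Type*} [CommMonoid M] (f : ℕ → M) (n : ℕ) :
    ∏ i ∈ Finset.range n, ∏ j ∈ Finset.range i, f j =
      ∏ j ∈ Finset.range n, f j ^ (n - 1 - j) := by
  induction n with
  | zero => simp
  | succ n ih =>
    rw [Finset.prod_range_succ, ih, Finset.prod_range_succ, ← Finset.prod_mul_distrib,
      Nat.add_sub_cancel, Nat.sub_self, pow_zero, mul_one]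
    refine Finset.prod_congr rfl fun j hj => ?_
    have hjn := Finset.mem_range.1 hj
    rw [← pow_succ, show n - 1 - j + 1 = n - j by omega]

lemma det_fderiv_stieltjesMap (z : Fin n → ℝ) :
    (fderiv ℝ (stieltjesMap n) z).det = ∏ i : Fin n, z i ^ (n - 1 - i : ℕ) := by
  rw [ContinuousLinearMap.det, ← LinearMap.det_toMatrix', Matrix.det_of_isLowerTriangular]
  · simp only [LinearMap.toMatrix'_apply, ContinuousLinearMap.coe_coe, fderiv_stieltjesMap_self,
      ← zeroExtend_val z]
    rw [Fin.prod_univ_eq_prod_range (fun i => ∏ j ∈ Finset.range i, zeroExtend z j),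
      Fin.prod_univ_eq_prod_range (fun i => zeroExtend z i ^ (n - 1 - i)), prod_range_prod_range]
  · intro i j hij
    rw [LinearMap.toMatrix'_apply]
    exact fderiv_stieltjesMap_of_lt z hij

lemma fderiv_stieltjesMap_one (i j : Fin n) :
    fderiv ℝ (stieltjesMap n) 1 (Pi.single j 1) i = matrixC n i j := by
  refine (hasDerivAt_stieltjesMap_update 1 i j).unique
    ((hasDerivAt_stieltjesMoment_update_one i j).congr_of_eventuallyEq (.of_forall fun t => ?_))
  refine stieltjesMoment_congr fun l hl => ?_
  rw [zeroExtend_update, Function.update_apply, Function.update_apply,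
    zeroExtend_of_lt 1 (by omega : l < n), Pi.one_apply]

lemma hasFDerivAt_stieltjesMap_one (n : ℕ) :
    HasFDerivAt (stieltjesMap n) (matrixC n).mulVecLin.toContinuousLinearMap 1 := by
  refine (differentiable_stieltjesMap n 1).hasFDerivAt.congr_fderiv ?_
  refine ContinuousLinearMap.coe_injective (LinearMap.pi_ext' fun j => LinearMap.ext_ring ?_)
  ext i
  simp [fderiv_stieltjesMap_one]

lemma det_matrixC (k : ℕ) : (matrixC k).det = 1 := by
  rw [Matrix.det_of_isLowerTriangular]
  · simp [matrixC]
  · intro i j hij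
    have hlt : i < j := hij
    rw [matrixC, if_neg hlt.ne', if_neg hlt.not_gt]

end Derivative

end StieltjesMap

section ChangeOfVariables

lemma lintegral_fintype_prod_eq_prod {ι : Type*} [Fintype ι] {E : ι → Type*}
    [∀ i, MeasurableSpace (E i)] {μ : ∀ i, Measure (E i)} [∀ i, SigmaFinite (μ i)]
    {f : ∀ i, E i → ENNReal} (hf : ∀ i, Measurable (f i)) :
    ∫⁻ x, ∏ i, f i (x i) ∂Measure.pi μ = ∏ i, ∫⁻ x, f i x ∂μ i := by
  classical
  have hprod (s : Finset ι) : Measurable fun x : ∀ i, E i => ∏ i ∈ s, f i (x i) := by fun_prop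
  have hmarginal (s : Finset ι) (x : ∀ i, E i) :
      (∫⋯∫⁻_s, fun x => ∏ i ∈ s, f i (x i) ∂μ) x = ∏ i ∈ s, ∫⁻ y, f i y ∂μ i := by
    induction s using Finset.induction_on generalizing x with
    | empty => simp
    | insert i s hi ih =>
      rw [lmarginal_insert _ (hprod _) hi, Finset.prod_insert hi, ← lintegral_mul_const _ (hf i)]
      refine lintegral_congr fun y => ?_
      rw [← ih (Function.update x i y), lmarginal, lmarginal]
      refine (lintegral_congr fun w => ?_).trans
        (lintegral_const_mul _ ((hprod s).comp measurable_updateFinset))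
      rw [Finset.prod_insert hi, Function.updateFinset, dif_neg hi, Function.update_self]
  rcases isEmpty_or_nonempty (∀ i, E i) with hempty | ⟨⟨x⟩⟩
  · obtain ⟨i, hi⟩ := isEmpty_pi.1 hempty
    rw [lintegral_of_isEmpty, Finset.prod_eq_zero (Finset.mem_univ i) (lintegral_of_isEmpty _ _)]
  · rw [lintegral_eq_lmarginal_univ x, hmarginal]

lemma pi_withDensity {ι : Type*} [Fintype ι] {E : ι → Type*}
    [∀ i, MeasurableSpace (E i)] {μ : ∀ i, Measure (E i)} [∀ i, SigmaFinite (μ i)]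
    {f : ∀ i, E i → ENNReal} (hf : ∀ i, Measurable (f i))
    [∀ i, SigmaFinite ((μ i).withDensity (f i))] :
    Measure.pi (fun i => (μ i).withDensity (f i)) =
      (Measure.pi μ).withDensity fun x => ∏ i, f i (x i) := by
  refine Measure.pi_eq fun s hs => ?_
  rw [withDensity_apply _ (MeasurableSet.univ_pi hs), Measure.restrict_pi_pi,
    lintegral_fintype_prod_eq_prod hf]
  exact Finset.prod_congr rfl fun i _ => (withDensity_apply _ (hs i)).symm

lemma withDensity_eq_map_withDensity_restrict {E : Type*} [NormedAddCommGroup E] [NormedSpace ℝ E]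
    [FiniteDimensional ℝ E] [MeasurableSpace E] [BorelSpace E] (μ : Measure E)
    [μ.IsAddHaarMeasure] {S : Set E} {f : E → E} {f' : E → E →L[ℝ] E} {g : E → ENNReal}
    (hS : MeasurableSet S) (hf : Measurable f) (hf' : ∀ x ∈ S, HasFDerivWithinAt f (f' x) S x)
    (hinj : Set.InjOn f S) (hg : ∀ y, g y ≠ 0 → y ∈ f '' S) :
    μ.withDensity g =
      ((μ.restrict S).withDensity fun x => ENNReal.ofReal |(f' x).det| * g (f x)).map f := by
  ext B hB
  have hsupport : (f '' S).indicator (B.indicator g) = B.indicator g :=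
    Set.indicator_eq_self.2 fun y hy => hg y fun h => hy (by simp [Set.indicator, h])
  rw [withDensity_apply _ hB, Measure.map_apply hf hB, withDensity_apply _ (hf hB),
    ← lintegral_indicator hB, ← lintegral_indicator (hf hB), ← hsupport,
    lintegral_indicator (measurable_image_of_fderivWithin hS hf' hinj),
    lintegral_image_eq_lintegral_abs_det_fderiv_mul μ hS hf' hinj]
  refine lintegral_congr fun x => ?_
  by_cases hx : f x ∈ B <;> simp [Set.indicator, hx]

lemma measurable_gammaPDF (a r : ℝ) : Measurable (gammaPDF a r) :=
  (measurable_gammaPDFReal a r).ennreal_ofReal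

lemma gammaMeasure_eq_withDensity_restrict_Ioi (a r : ℝ) :
    gammaMeasure a r = (volume.restrict (Set.Ioi 0)).withDensity (gammaPDF a r) := by
  rw [← restrict_withDensity measurableSet_Ioi, ← gammaMeasure, Measure.restrict_eq_self_of_ae_mem]
  rw [gammaMeasure, ae_withDensity_iff (measurable_gammaPDF a r)]
  filter_upwards [Measure.ae_ne volume (0 : ℝ)] with x hx0 hpdf
  by_contra hx
  exact hpdf (gammaPDF_of_neg ((not_lt.1 hx).lt_of_ne hx0))

variable {n : ℕ} {γ δ : ℕ → ℝ}

lemma momentDensity_stieltjesMap_mul {z : Fin n → ℝ} (hz : ∀ i, 0 < z i) (γ δ : ℕ → ℝ) :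
    momentDensity n γ δ (stieltjesMap n z) * ∏ i : Fin n, z i ^ (n - 1 - i : ℕ) =
      ∏ i : Fin n, gammaPDFReal (γ (i + 1) + n - (i + 1 : ℕ) + 1) (δ (i + 1)) (z i) := by
  have hreindex (f : ℕ → ℝ) : ∏ k ∈ Finset.Icc 1 n, f k = ∏ i : Fin n, f (i + 1) := by
    rw [Fin.prod_univ_eq_prod_range (fun i => f (i + 1)), ← Finset.Ico_succ_right_eq_Icc,
      Finset.prod_Ico_eq_prod_range]
    simp [add_comm]
  rw [momentDensity, if_pos ⟨stieltjesMap_mem_momentSpace fun i => (hz i).le,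
    fun k hk => lowerMoment_stieltjesMap_lt hz (Finset.mem_Icc.1 hk).2⟩, hreindex, hreindex,
    ← Finset.prod_mul_distrib, ← Finset.prod_mul_distrib]
  refine Finset.prod_congr rfl fun i _ => ?_
  have hexponent : γ (i + 1) + n - (i + 1 : ℕ) + 1 - 1 = γ (i + 1) + (n - 1 - i : ℕ) := by
    rw [Nat.sub_sub, Nat.cast_sub (by omega)]
    push_cast
    ring
  rw [recursionVar_stieltjesMap hz, gammaPDFReal, if_pos (hz i).le, hexponent,
    Real.rpow_add (hz i), Real.rpow_natCast, neg_mul]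
  ring

lemma momentLaw_eq_map_pi_gammaMeasure
    (hγ : ∀ i : Fin n, 0 < γ (i + 1) + n - (i + 1 : ℕ) + 1) (hδ : ∀ i : Fin n, 0 < δ (i + 1)) :
    momentLaw n γ δ = (Measure.pi fun i : Fin n =>
      gammaMeasure (γ (i + 1) + n - (i + 1 : ℕ) + 1) (δ (i + 1))).map (stieltjesMap n) := by
  have horthant : {z : Fin n → ℝ | ∀ i, 0 < z i} = Set.univ.pi fun _ => Set.Ioi 0 := by
    ext
    simp
  have hmeas : MeasurableSet {z : Fin n → ℝ | ∀ i, 0 < z i} :=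
    horthant ▸ MeasurableSet.univ_pi fun _ => measurableSet_Ioi
  have hprob (i : Fin n) := isProbabilityMeasure_gammaMeasure (hγ i) (hδ i)
  simp only [gammaMeasure_eq_withDensity_restrict_Ioi] at hprob ⊢
  rw [pi_withDensity fun i => measurable_gammaPDF _ _, ← Measure.restrict_pi_pi, ← horthant,
    ← volume_pi, momentLaw, withDensity_eq_map_withDensity_restrict volume hmeas
      (differentiable_stieltjesMap n).continuous.measurable
      (fun z _ => (differentiable_stieltjesMap n z).hasFDerivAt.hasFDerivWithinAt)
      (injOn_stieltjesMap n)]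
  · refine congrArg _ (withDensity_congr_ae <| (ae_restrict_mem hmeas).mono fun z hz => ?_)
    have hdet : 0 ≤ ∏ i : Fin n, z i ^ (n - 1 - i : ℕ) :=
      Finset.prod_nonneg fun i _ => pow_nonneg (hz i).le _
    simp only [gammaPDF, det_fderiv_stieltjesMap]
    rw [← ENNReal.ofReal_prod_of_nonneg fun i _ => gammaPDFReal_nonneg (hγ i) (hδ i) _,
      ← momentDensity_stieltjesMap_mul hz γ δ, abs_of_nonneg hdet, ← ENNReal.ofReal_mul hdet,
      mul_comm]
  · intro m hm
    refine exists_stieltjesMap_eq ?_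
    by_contra hlower
    exact hm (by rw [momentDensity, if_neg fun h => hlower h.2, ENNReal.ofReal_zero])

end ChangeOfVariables

section GammaDistribution

lemma eqOn_re_lt_of_eq_ofReal {f g : ℂ → ℂ} {r : ℝ} (hf : AnalyticOnNhd ℂ f {z | z.re < r})
    (hg : AnalyticOnNhd ℂ g {z | z.re < r}) (hfg : ∀ t : ℝ, t < r → f t = g t) :
    Set.EqOn f g {z | z.re < r} := by
  obtain ⟨s, hs⟩ := exists_lt r
  refine hf.eqOn_of_preconnected_of_frequently_eq hg (convex_halfSpace_re_lt r).isPreconnected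
    (z₀ := (s : ℂ)) hs ?_
  have hofReal : Tendsto Complex.ofReal (𝓝[≠] s) (𝓝[≠] (s : ℂ)) :=
    Complex.continuous_ofReal.continuousAt.continuousWithinAt.tendsto_nhdsWithin
      fun t ht => Complex.ofReal_injective.ne ht
  refine hofReal.frequently (Eventually.frequently ?_)
  filter_upwards [nhdsWithin_le_nhds (Iio_mem_nhds hs)] with t ht
  exact hfg t ht

variable {a r : ℝ}

lemma mgf_gammaMeasure (ha : 0 < a) (hr : 0 < r) {t : ℝ} (ht : t < r) :
    mgf id (gammaMeasure a r) t = (1 - t / r) ^ (-a) := by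
  have hrt : 0 < r - t := sub_pos.2 ht
  have hintegrand (x : ℝ) (hx : x ∈ Set.Ioi 0) :
      (gammaPDF a r x).toReal • Real.exp (t * id x) =
        r ^ a / Real.Gamma a * (x ^ (a - 1) * Real.exp (-((r - t) * x))) := by
    rw [gammaPDF, ENNReal.toReal_ofReal (gammaPDFReal_nonneg ha hr x), gammaPDFReal,
      if_pos (Set.mem_Ioi.1 hx).le, smul_eq_mul, mul_assoc, ← Real.exp_add, ← mul_assoc, id]
    ring_nf
  rw [mgf, gammaMeasure_eq_withDensity_restrict_Ioi,
    integral_withDensity_eq_integral_toReal_smul (measurable_gammaPDF a r)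
      (ae_of_all _ fun x => ENNReal.ofReal_lt_top),
    setIntegral_congr_fun measurableSet_Ioi hintegrand, integral_const_mul,
    Real.integral_rpow_mul_exp_neg_mul_Ioi ha hrt, one_sub_div hr.ne',
    Real.rpow_neg (by positivity),
    Real.div_rpow hrt.le hr.le, Real.div_rpow zero_le_one hrt.le, Real.one_rpow]
  have hGamma := (Real.Gamma_pos_of_pos ha).ne'
  field_simp

lemma Iio_subset_integrableExpSet_gammaMeasure (ha : 0 < a) (hr : 0 < r) :
    Set.Iio r ⊆ integrableExpSet id (gammaMeasure a r) := by
  intro t ht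
  have hpos : 0 < mgf id (gammaMeasure a r) t := by
    rw [mgf_gammaMeasure ha hr ht]
    exact Real.rpow_pos_of_pos (sub_pos.2 ((div_lt_one hr).2 ht)) _
  exact not_imp_comm.1 integral_undef hpos.ne'

lemma complexMGF_gammaMeasure (ha : 0 < a) (hr : 0 < r) {z : ℂ} (hz : z.re < r) :
    complexMGF id (gammaMeasure a r) z = (1 - z / r) ^ (-(a : ℂ)) := by
  refine eqOn_re_lt_of_eq_ofReal (f := complexMGF id (gammaMeasure a r))
    (g := fun w => (1 - w / r) ^ (-(a : ℂ))) (analyticOnNhd_complexMGF.mono fun w hw => ?_)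
    (DifferentiableOn.analyticOnNhd (fun w hw => ?_)
      (isOpen_Iio.preimage Complex.continuous_re)) (fun t ht => ?_) hz
  · exact interior_mono (Iio_subset_integrableExpSet_gammaMeasure ha hr)
      (by rwa [interior_Iio])
  · have hslit : 1 - w / r ∈ Complex.slitPlane :=
      .inl (by simpa [Complex.div_ofReal_re] using (div_lt_one hr).2 hw)
    have hdiff : DifferentiableAt ℂ (fun w : ℂ => 1 - w / r) w := by fun_prop
    exact (hdiff.cpow_const hslit).differentiableWithinAt
  · have hbase : 0 ≤ 1 - t / r := sub_nonneg.2 ((div_lt_one hr).2 ht).le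
    rw [complexMGF_ofReal, mgf_gammaMeasure ha hr ht, Complex.ofReal_cpow hbase]
    push_cast
    rfl

lemma charFun_map_const_mul_sub_one (μ : Measure ℝ) (s t : ℝ) :
    charFun (μ.map fun x => s * (x - 1)) t =
      Complex.exp (-(t * s * Complex.I)) * complexMGF id μ (t * s * Complex.I) := by
  rw [charFun_apply_real, integral_map (by fun_prop) (by fun_prop), complexMGF,
    ← integral_const_mul]
  refine integral_congr_ae (.of_forall fun x => ?_)
  simp only [← Complex.exp_add, id]
  push_cast
  ring_nf

lemma tendsto_mul_sub_log_one_add {ι : Type*} {l : Filter ι} {b u : ι → ℂ} {L : ℂ}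
    (hu : Tendsto u l (𝓝 0)) (hbu : Tendsto (fun i => b i * u i ^ 2) l (𝓝 L)) :
    Tendsto (fun i => b i * (u i - Complex.log (1 + u i))) l (𝓝 (L / 2)) := by
  have htaylor (w : ℂ) : Complex.logTaylor 3 w = w - w ^ 2 / 2 := by
    norm_num [Complex.logTaylor_succ, Complex.logTaylor_zero]
    ring
  have hcubic : Tendsto (fun i => b i * u i ^ 3) l (𝓝 0) := by
    simpa only [mul_zero, mul_assoc, ← pow_succ] using hbu.mul hu
  have hremainder : Tendsto (fun i => b i * (Complex.log (1 + u i) - Complex.logTaylor 3 (u i))) l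
      (𝓝 0) :=
    ((Asymptotics.isBigO_refl b l).mul
      ((Complex.log_sub_logTaylor_isBigO 2).comp_tendsto hu)).trans_tendsto hcubic
  rw [← sub_zero (L / 2)]
  refine ((hbu.div_const 2).sub hremainder).congr fun i => ?_
  rw [htaylor]
  ring

lemma charFun_map_const_mul_sub_one_gammaMeasure (ha : 0 < a) (hr : 0 < r) (s t : ℝ) :
    charFun ((gammaMeasure a r).map fun x => s * (x - 1)) t =
      Complex.exp (-(t * s * Complex.I) - a * Complex.log (1 - t * s * Complex.I / r)) := by
  have hre : (1 - t * s * Complex.I / r).re = 1 := by simp [Complex.div_ofReal_re]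
  have hbase : 1 - t * s * Complex.I / r ≠ 0 := fun h => by simp [h] at hre
  rw [charFun_map_const_mul_sub_one, complexMGF_gammaMeasure ha hr (by simpa using hr),
    Complex.cpow_def_of_ne_zero hbase, ← Complex.exp_add]
  ring_nf

lemma tendsto_sqrt_div_self_atTop : Tendsto (fun r : ℝ => √r / r) atTop (𝓝 0) := by
  simp only [Real.sqrt_div_self]
  exact tendsto_inv_atTop_zero.comp Real.tendsto_sqrt_atTop

theorem tendsto_charFun_map_gammaMeasure (c t : ℝ) :
    Tendsto (fun r : ℝ => charFun ((gammaMeasure (r + c) r).map fun x => √r * (x - 1)) t) atTop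
      (𝓝 (charFun (gaussianReal 0 1) t)) := by
  obtain ⟨u, hu⟩ : ∃ u : ℝ → ℂ, ∀ r : ℝ, u r = -(t * √r * Complex.I / r) := ⟨_, fun _ => rfl⟩
  have hsqrt {r : ℝ} (hr : 0 < r) : (√r : ℂ) ^ 2 = r := by
    rw [← Complex.ofReal_pow, Real.sq_sqrt hr.le]
  have hu_zero : Tendsto u atTop (𝓝 0) := by
    have hmul := ((Complex.continuous_ofReal.tendsto 0).comp tendsto_sqrt_div_self_atTop).const_mul
      (-t * Complex.I)
    rw [Complex.ofReal_zero, mul_zero] at hmul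
    refine hmul.congr fun r => ?_
    rw [hu, Function.comp_apply, Complex.ofReal_div]
    ring
  have hu_sq : Tendsto (fun r : ℝ => (r : ℂ) * u r ^ 2) atTop (𝓝 (-t ^ 2)) := by
    refine tendsto_const_nhds.congr' ?_
    filter_upwards [eventually_gt_atTop 0] with r hr
    have hne : (r : ℂ) ≠ 0 := Complex.ofReal_ne_zero.2 hr.ne'
    rw [hu, neg_sq, div_pow, mul_pow, mul_pow, Complex.I_sq, hsqrt hr]
    field_simp
  have hlog : Tendsto (fun r => Complex.log (1 + u r)) atTop (𝓝 0) := by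
    have hone : Tendsto (fun r => 1 + u r) atTop (𝓝 1) := by simpa using hu_zero.const_add 1
    simpa using hone.clog (by simp)
  have hexp := (Complex.continuous_exp.tendsto _).comp
    ((tendsto_mul_sub_log_one_add hu_zero hu_sq).sub (hlog.const_mul (c : ℂ)))
  rw [charFun_gaussianReal]
  convert hexp.congr' ?_ using 2
  · simp [neg_div]
  · filter_upwards [eventually_gt_atTop 0, eventually_gt_atTop (-c)] with r hr hrc
    have hlinear : -(t * √r * Complex.I) = r * u r := by
      rw [hu, mul_neg, mul_div_cancel₀ _ (Complex.ofReal_ne_zero.2 hr.ne')]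
    rw [charFun_map_const_mul_sub_one_gammaMeasure (by linarith) hr, sub_eq_add_neg 1, ← hu,
      hlinear, Function.comp_apply]
    push_cast
    ring_nf

end GammaDistribution

section MarchenkoPastur

variable {α β : ℝ}

lemma betaPDFReal_nonneg (hα : 0 < α) (hβ : 0 < β) (x : ℝ) : 0 ≤ betaPDFReal α β x := by
  by_cases hx : 0 < x ∧ x < 1
  · exact (betaPDFReal_pos hx.1 hx.2 hα hβ).le
  · rw [betaPDFReal, if_neg hx]

lemma integrable_betaPDFReal (hα : 0 < α) (hβ : 0 < β) : Integrable (betaPDFReal α β) := by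
  refine ⟨by fun_prop, ?_⟩
  rw [hasFiniteIntegral_iff_ofReal (ae_of_all _ (betaPDFReal_nonneg hα hβ))]
  exact (lintegral_betaPDF_eq_one hα hβ).trans_lt ENNReal.one_lt_top

lemma integral_betaPDFReal (hα : 0 < α) (hβ : 0 < β) : ∫ x, betaPDFReal α β x = 1 := by
  rw [integral_eq_lintegral_of_nonneg_ae (ae_of_all _ (betaPDFReal_nonneg hα hβ)) (by fun_prop)]
  exact (congrArg _ (lintegral_betaPDF_eq_one hα hβ)).trans ENNReal.toReal_one

lemma beta_add_one_left (hα : 0 < α) (hβ : 0 < β) :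
    beta (α + 1) β = beta α β * (α / (α + β)) := by
  have hGamma := (Real.Gamma_pos_of_pos (add_pos hα hβ)).ne'
  rw [beta, beta, Real.Gamma_add_one hα.ne', add_right_comm, Real.Gamma_add_one (by positivity)]
  field_simp

lemma beta_three_halves_three_halves : beta (3 / 2) (3 / 2) = Real.pi / 8 := by
  have hGamma : Real.Gamma (3 / 2) = √Real.pi / 2 := by
    rw [show (3 / 2 : ℝ) = 1 / 2 + 1 by norm_num, Real.Gamma_add_one (by norm_num),
      Real.Gamma_one_half_eq]
    ring
  rw [beta, hGamma, show (3 / 2 + 3 / 2 : ℝ) = (2 : ℕ) + 1 by norm_num,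
    Real.Gamma_nat_eq_factorial, div_mul_div_comm, Real.mul_self_sqrt Real.pi_pos.le]
  norm_num [Nat.factorial]
  ring

lemma catalan_succ_mul (n : ℕ) : (n + 2) * catalan (n + 1) = 2 * (2 * n + 1) * catalan n := by
  refine Nat.eq_of_mul_eq_mul_left n.succ_pos ?_
  have hsucc := Nat.succ_mul_centralBinom_succ n
  rw [← succ_mul_catalan_eq_centralBinom n, ← succ_mul_catalan_eq_centralBinom (n + 1)] at hsucc
  rw [Nat.succ_eq_add_one]
  linarith

lemma four_pow_mul_beta_eq_catalan (i : ℕ) :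
    4 ^ (i + 2) / (2 * Real.pi) * beta (i + 3 / 2) (3 / 2) = catalan (i + 1) := by
  induction i with
  | zero =>
    have hpi := Real.pi_ne_zero
    rw [Nat.cast_zero, zero_add (3 / 2 : ℝ), beta_three_halves_three_halves, catalan_one]
    field_simp
    norm_num
  | succ i ih =>
    have hcatalan : ((i : ℝ) + 3) * catalan (i + 2) = 2 * (2 * i + 3) * catalan (i + 1) := by
      have h := congrArg (Nat.cast (R := ℝ)) (catalan_succ_mul (i + 1))
      push_cast at h
      linarith
    refine mul_left_cancel₀ (show (i : ℝ) + 3 ≠ 0 by positivity) ?_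
    rw [hcatalan, ← ih, show ((i + 1 : ℕ) : ℝ) + 3 / 2 = i + 3 / 2 + 1 by push_cast; ring,
      beta_add_one_left (by positivity) (by norm_num)]
    field_simp
    ring

/-- The density of the Marchenko–Pastur distribution. -/
noncomputable def marchenkoPasturPDFReal : ℝ → ℝ :=
  (Set.Ioo (0 : ℝ) 4).indicator fun x => √(x * (4 - x)) / (2 * Real.pi * x)

lemma measurable_marchenkoPasturPDFReal : Measurable marchenkoPasturPDFReal :=
  Measurable.indicator (by fun_prop) measurableSet_Ioo

lemma marchenkoPasturPDFReal_nonneg (x : ℝ) : 0 ≤ marchenkoPasturPDFReal x := by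
  refine Set.indicator_nonneg (fun y hy => ?_) x
  have hy_pos := hy.1
  positivity

lemma marchenkoPasturPDFReal_mul_pow (i : ℕ) (x : ℝ) :
    marchenkoPasturPDFReal x * x ^ (i + 1) =
      4 ^ (i + 1) / (2 * Real.pi) * beta (i + 3 / 2) (3 / 2) *
        betaPDFReal (i + 3 / 2) (3 / 2) (x / 4) := by
  rw [marchenkoPasturPDFReal, betaPDFReal]
  by_cases hx : x ∈ Set.Ioo (0 : ℝ) 4
  · obtain ⟨hx0, hx4⟩ := hx
    have hbeta := (beta_pos (α := i + 3 / 2) (β := 3 / 2) (by positivity) (by norm_num)).ne'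
    have hpow : (x / 4) ^ ((i : ℝ) + 3 / 2 - 1) = (x / 4) ^ i * √(x / 4) := by
      rw [show (i : ℝ) + 3 / 2 - 1 = i + 1 / 2 by ring, Real.rpow_add (by positivity),
        Real.rpow_natCast, Real.sqrt_eq_rpow]
    have hsqrt_one_sub : (1 - x / 4) ^ ((3 / 2 : ℝ) - 1) = √(1 - x / 4) := by
      rw [Real.sqrt_eq_rpow]
      norm_num
    have hsqrt : √(x * (4 - x)) = 4 * (√(x / 4) * √(1 - x / 4)) := by
      rw [← Real.sqrt_mul (by positivity), show x * (4 - x) = 4 ^ 2 * (x / 4 * (1 - x / 4)) by ring,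
        Real.sqrt_mul (by norm_num), Real.sqrt_sq (by norm_num)]
    rw [Set.indicator_of_mem (Set.mem_Ioo.2 ⟨hx0, hx4⟩), if_pos ⟨by positivity, by linarith⟩, hpow,
      hsqrt_one_sub, hsqrt, div_pow]
    generalize beta (i + 3 / 2) (3 / 2) = b at hbeta ⊢
    field_simp
    ring
  · rw [Set.indicator_of_notMem hx, if_neg, zero_mul, mul_zero]
    exact fun h => hx ⟨by linarith [h.1], by linarith [h.2]⟩

lemma integrable_pow_marchenkoPastur_and_integral_eq (i : ℕ) :
    Integrable (fun x : ℝ => x ^ (i + 1)) marchenkoPastur ∧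
      ∫ x, x ^ (i + 1) ∂marchenkoPastur = catalan (i + 1) := by
  have hα : (0 : ℝ) < i + 3 / 2 := by positivity
  have hβ : (0 : ℝ) < 3 / 2 := by norm_num
  have hmeas := measurable_marchenkoPasturPDFReal.ennreal_ofReal
  have hlt : ∀ᵐ x : ℝ, ENNReal.ofReal (marchenkoPasturPDFReal x) < ⊤ :=
    ae_of_all _ fun x => ENNReal.ofReal_lt_top
  change Integrable _ (volume.withDensity fun x => ENNReal.ofReal (marchenkoPasturPDFReal x)) ∧
    ∫ x, _ ∂volume.withDensity (fun x => ENNReal.ofReal (marchenkoPasturPDFReal x)) = _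
  rw [integrable_withDensity_iff_integrable_smul' hmeas hlt,
    integral_withDensity_eq_integral_toReal_smul hmeas hlt]
  simp only [ENNReal.toReal_ofReal (marchenkoPasturPDFReal_nonneg _), smul_eq_mul,
    marchenkoPasturPDFReal_mul_pow]
  refine ⟨((integrable_betaPDFReal hα hβ).comp_div (by norm_num)).const_mul _, ?_⟩
  rw [integral_const_mul, Measure.integral_comp_div (fun x => betaPDFReal (i + 3 / 2) (3 / 2) x),
    integral_betaPDFReal hα hβ, ← four_pow_mul_beta_eq_catalan, smul_eq_mul,
    abs_of_pos (by norm_num : (0 : ℝ) < 4)]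
  ring

lemma marchenkoPasturMoments_eq_stieltjesMap_one (k : ℕ) :
    marchenkoPasturMoments k = stieltjesMap k 1 :=
  funext fun i => (integrable_pow_marchenkoPastur_and_integral_eq i).2.trans
    (stieltjesMap_one i).symm

end MarchenkoPastur

section GammaFluctuations

variable {γ : ℕ → ℝ}

/-- The joint law under which the canonical coordinates `z₁, …, zₙ` of a moment vector are
independent Gamma variables, for the density `g_n^{(γ,δ)}` with `δ₁ = ⋯ = δₙ = n`. -/
noncomputable def canonicalLaw (γ : ℕ → ℝ) (n : ℕ) : Measure (Fin n → ℝ) :=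
  Measure.pi fun i : Fin n => gammaMeasure (γ (i + 1) + n - (i + 1 : ℕ) + 1) n

lemma shape_pos (hγ : ∀ k, 1 ≤ k → -1 < γ k) {n : ℕ} (i : Fin n) :
    0 < γ (i + 1) + n - (i + 1 : ℕ) + 1 := by
  have hle : ((i + 1 : ℕ) : ℝ) ≤ n := Nat.cast_le.2 i.2
  linarith [hγ (i + 1) (Nat.le_add_left 1 i)]

lemma isProbabilityMeasure_gammaMeasure_shape (hγ : ∀ k, 1 ≤ k → -1 < γ k) {n : ℕ} (i : Fin n) :
    IsProbabilityMeasure (gammaMeasure (γ (i + 1) + n - (i + 1 : ℕ) + 1) n) :=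
  isProbabilityMeasure_gammaMeasure (shape_pos hγ i) (Nat.cast_pos.2 i.pos)

lemma isProbabilityMeasure_canonicalLaw (hγ : ∀ k, 1 ≤ k → -1 < γ k) (n : ℕ) :
    IsProbabilityMeasure (canonicalLaw γ n) := by
  have hprob := isProbabilityMeasure_gammaMeasure_shape hγ (n := n)
  exact inferInstanceAs (IsProbabilityMeasure (Measure.pi _))

lemma momentLaw_eq_map_canonicalLaw (hγ : ∀ k, 1 ≤ k → -1 < γ k) (n : ℕ) :
    momentLaw n γ (fun _ => (n : ℝ)) = (canonicalLaw γ n).map (stieltjesMap n) :=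
  momentLaw_eq_map_pi_gammaMeasure (shape_pos hγ) fun i => Nat.cast_pos.2 i.pos

lemma measurable_firstCoords (k n : ℕ) :
    Measurable (firstCoords k : (Fin n → ℝ) → Fin k → ℝ) := by
  refine measurable_pi_lambda _ fun i => ?_
  unfold firstCoords
  split_ifs <;> fun_prop

lemma map_sqrt_mul_firstCoords_canonicalLaw (hγ : ∀ k, 1 ≤ k → -1 < γ k) {k n : ℕ} (hkn : k ≤ n)
    (i : Fin k) :
    (canonicalLaw γ n).map (fun z => √n * (firstCoords k z i - 1)) =
      (gammaMeasure (n + (γ (i + 1) - i)) n).map fun x => √n * (x - 1) := by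
  have hprob := isProbabilityMeasure_gammaMeasure_shape hγ (n := n)
  have heval := (measurePreserving_eval (fun j : Fin n =>
    gammaMeasure (γ (j + 1) + n - (j + 1 : ℕ) + 1) n) (i.castLE hkn)).map_eq
  have hshape : (n : ℝ) + (γ (i + 1) - i) = γ (i + 1) + n - (i + 1 : ℕ) + 1 := by
    push_cast
    ring
  simp only [firstCoords, dif_pos (i.2.trans_le hkn)]
  rw [hshape]
  refine Eq.trans ?_ (congrArg (Measure.map fun x => √n * (x - 1)) heval)
  rw [Measure.map_map (by fun_prop) (by fun_prop)]
  rfl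

lemma tendstoInDistribution_sqrt_mul_firstCoords (hγ : ∀ k, 1 ≤ k → -1 < γ k)
    [∀ n, IsProbabilityMeasure (canonicalLaw γ n)] {k : ℕ} (i : Fin k) :
    TendstoInDistribution (fun (n : ℕ) z => √n * (firstCoords k z i - 1)) atTop
      (fun w : Fin k → ℝ => w i) (canonicalLaw γ) (Measure.pi fun _ => gaussianReal 0 1) := by
  refine ⟨fun n => ((measurable_pi_iff.1 (measurable_firstCoords k n) i).sub_const 1
    |>.const_mul _).aemeasurable, (measurable_pi_apply i).aemeasurable,
    ProbabilityMeasure.tendsto_iff_tendsto_charFun.2 fun t => ?_⟩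
  have heval : (Measure.pi fun _ : Fin k => gaussianReal 0 1).map (fun w => w i) =
      gaussianReal 0 1 := (measurePreserving_eval _ i).map_eq
  simp only [ProbabilityMeasure.coe_mk, heval]
  refine ((tendsto_charFun_map_gammaMeasure (γ (i + 1) - i) t).comp
    tendsto_natCast_atTop_atTop).congr' ?_
  filter_upwards [eventually_ge_atTop k] with n hkn
  rw [map_sqrt_mul_firstCoords_canonicalLaw hγ hkn, Function.comp_apply]

lemma iIndepFun_sqrt_mul_firstCoords (hγ : ∀ k, 1 ≤ k → -1 < γ k) {k n : ℕ} (hkn : k ≤ n) :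
    iIndepFun (fun (i : Fin k) z => √n * (firstCoords k z i - 1)) (canonicalLaw γ n) := by
  have hprob := isProbabilityMeasure_gammaMeasure_shape hγ (n := n)
  have hindep := (iIndepFun_pi (μ := fun i : Fin n =>
    gammaMeasure (γ (i + 1) + n - (i + 1 : ℕ) + 1) n) (X := fun _ x => √n * (x - 1))
    fun _ => by fun_prop).precomp (Fin.castLE_injective hkn)
  simp only [firstCoords, dif_pos (Fin.is_lt _ |>.trans_le hkn)]
  exact hindep

theorem tendstoInDistribution_sqrt_smul_firstCoords_canonicalLaw (hγ : ∀ k, 1 ≤ k → -1 < γ k)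
    [∀ n, IsProbabilityMeasure (canonicalLaw γ n)] (k : ℕ) :
    TendstoInDistribution (fun (n : ℕ) z => √n • (firstCoords k z - 1)) atTop
      (id : (Fin k → ℝ) → Fin k → ℝ) (canonicalLaw γ) (Measure.pi fun _ => gaussianReal 0 1) :=
  tendstoInDistribution_pi_of_iIndepFun (tendstoInDistribution_sqrt_mul_firstCoords hγ)
    ((eventually_ge_atTop k).mono fun _ hkn => iIndepFun_sqrt_mul_firstCoords hγ hkn)
    (iIndepFun_pi (X := fun _ x => x) fun _ => aemeasurable_id)

/-- The rescaled fluctuation of the first `k` of `n` moments around the moments of the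
Marchenko–Pastur distribution. -/
noncomputable def normalizedMoments (k n : ℕ) (m : Fin n → ℝ) : EuclideanSpace ℝ (Fin k) :=
  WithLp.toLp 2 (√n • (matrixC k)⁻¹.mulVec (firstCoords k m - marchenkoPasturMoments k))

lemma continuous_toLp_inv_matrixC_mulVec (k : ℕ) :
    Continuous fun v : Fin k → ℝ => WithLp.toLp 2 ((matrixC k)⁻¹.mulVec v) :=
  (PiLp.continuous_toLp 2 _).comp (continuous_const.matrix_mulVec continuous_id)

lemma measurable_normalizedMoments (k n : ℕ) : Measurable (normalizedMoments k n) := by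
  have hsmul : Measurable fun m : Fin n → ℝ =>
      √n • (firstCoords k m - marchenkoPasturMoments k) := by
    have hfirst := measurable_firstCoords k n
    fun_prop
  unfold normalizedMoments
  simp only [← Matrix.mulVec_smul]
  exact (continuous_toLp_inv_matrixC_mulVec k).measurable.comp hsmul

lemma hasLaw_normalizedMoments (hγ : ∀ k, 1 ≤ k → -1 < γ k) {k n : ℕ} (hkn : k ≤ n) :
    HasLaw (normalizedMoments k n)
      ((canonicalLaw γ n).map fun z => WithLp.toLp 2 ((matrixC k)⁻¹.mulVec
        (√n • (stieltjesMap k (firstCoords k z) - stieltjesMap k 1))))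
      (momentLaw n γ fun _ => (n : ℝ)) := by
  refine ⟨(measurable_normalizedMoments k n).aemeasurable, ?_⟩
  rw [momentLaw_eq_map_canonicalLaw hγ, Measure.map_map (measurable_normalizedMoments k n)
    (differentiable_stieltjesMap n).continuous.measurable]
  simp only [Function.comp_def, normalizedMoments, firstCoords_stieltjesMap hkn,
    marchenkoPasturMoments_eq_stieltjesMap_one, Matrix.mulVec_smul]

theorem tendstoInDistribution_firstCoords_stieltjesMap (hγ : ∀ k, 1 ≤ k → -1 < γ k)
    [∀ n, IsProbabilityMeasure (canonicalLaw γ n)] (k : ℕ) :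
    TendstoInDistribution
      (fun (n : ℕ) z => WithLp.toLp 2 ((matrixC k)⁻¹.mulVec
        (√n • (stieltjesMap k (firstCoords k z) - stieltjesMap k 1)))) atTop
      (WithLp.toLp 2 : (Fin k → ℝ) → EuclideanSpace ℝ (Fin k)) (canonicalLaw γ)
      (Measure.pi fun _ => gaussianReal 0 1) := by
  have hdelta := (tendstoInDistribution_smul_sub_of_hasFDerivAt
    (differentiable_stieltjesMap k).continuous (hasFDerivAt_stieltjesMap_one k)
    (Real.tendsto_sqrt_atTop.comp tendsto_natCast_atTop_atTop)
    (tendstoInDistribution_sqrt_smul_firstCoords_canonicalLaw hγ k)).continuous_comp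
    (continuous_toLp_inv_matrixC_mulVec k)
  refine hdelta.congr (fun n => .rfl) (.of_eq <| funext fun w => ?_)
  have hdet : IsUnit (matrixC k).det := det_matrixC k ▸ isUnit_one
  simp [Matrix.nonsing_inv_mul _ hdet]

end GammaFluctuations

theorem mainTheorem1
    (γ : ℕ → ℝ) (hγ : ∀ k, 1 ≤ k → -1 < γ k)
    {Ω : ℕ → Type*} [∀ n, MeasurableSpace (Ω n)]
    (P : ∀ n, Measure (Ω n)) [∀ n, IsProbabilityMeasure (P n)]
    (M : ∀ n, Ω n → (Fin n → ℝ))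
    (hM : ∀ n, HasLaw (M n) (momentLaw n γ (fun _ => (n : ℝ))) (P n))
    (k : ℕ) :
    (∀ i : Fin k, Integrable (fun x : ℝ => x ^ ((i : ℕ) + 1)) marchenkoPastur ∧
      marchenkoPasturMoments k i = (catalan ((i : ℕ) + 1) : ℝ)) ∧
    TendstoInDistribution
      (fun (n : ℕ) (ω : Ω n) => WithLp.toLp 2
        (√(n : ℝ) • (matrixC k)⁻¹.mulVec (firstCoords k (M n ω) - marchenkoPasturMoments k)))
      Filter.atTop
      (id : EuclideanSpace ℝ (Fin k) → EuclideanSpace ℝ (Fin k))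
      P
      (multivariateGaussian 0 (1 : Matrix (Fin k) (Fin k) ℝ)) := by
  have hprob := isProbabilityMeasure_canonicalLaw hγ
  refine ⟨fun i => integrable_pow_marchenkoPastur_and_integral_eq i,
    tendstoInDistribution_of_eventually_map_eq
      (tendstoInDistribution_firstCoords_stieltjesMap hγ k) (fun n => ?_) aemeasurable_id ?_ ?_⟩
  · exact (measurable_normalizedMoments k n).comp_aemeasurable (hM n).aemeasurable
  · filter_upwards [eventually_ge_atTop k] with n hkn
    exact ((hasLaw_normalizedMoments hγ hkn).comp (hM n)).map_eq
  · rw [Measure.map_id, multivariateGaussian_zero_one, map_pi_eq_stdGaussian]
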